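/- Let $p$ be a prime. A $p$-graph $\Gamma=(\mathcal V,\mathcal E,f)$ consists of a finite set $\mathcal V$ of vertices, a set $\mathcal E\subseteq \mathcal V\times\mathcal V$ of oriented edges without loops and such that $(v,w)\in\mathcal E$ implies $(w,v)\notin\mathcal E$, and a labelling $f=(f_1,f_2)$ of the edges with values in $p\mathbb{Z}_p\times p\mathbb{Z}_p$ if $p$ is odd, and in $4\mathbb{Z}_2\times 4\mathbb{Z}_2$ if $p=2$. The associated $p$-RAAG is the pro-$p$ group given by the pro-$p$ presentation $$G_\Gamma=\langle\, \mathcal V \mid [x,y]=x^{f_1(e)}\,y^{f_2(e)}\ \text{ for every edge } e=(x,y)\in\mathcal E \,\rangle,\qquad [x,y]=x^{-1}y^{-1}xy .$$ A pro-$p$ group $G$ is powerful if $[G,G]\le G^p$ (for $p$ odd), respectively $[G,G]\le G^4$ (for $p=2$), where $[G,G]$ and $G^n$ are the closed subgroups generated by the commutators and by the $n$-th powers. It is uniform if it is (topologically) finitely generated, powerful, and $|P_i(G):P_{i+1}(G)|=|G:P_2(G)|$ for all $i\ge 1$, where $P_1(G)=G$ and $P_{i+1}(G)=P_i(G)^p[P_i(G),G]$.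 It is quadratic if its continuous cohomology algebra $H^\bullet(G,\mathbb{F}_p)$ with the cup product is isomorphic, as a graded algebra, to $T_\bullet(H^1)/(\Omega)$ for some $\Omega\subseteq H^1\otimes H^1$, where $H^1=H^1(G,\mathbb{F}_p)$, $T_\bullet(H^1)$ is its tensor algebra and $(\Omega)$ is the two-sided ideal generated by $\Omega$. **Theorem I.** Let $G_\Gamma$ be the $p$-RAAG associated with a $p$-graph $\Gamma$. Then $G_\Gamma$ is powerful or contains a closed subgroup that is a free non-abelian pro-$p$ group. In particular, if $G_\Gamma$ is quadratic, then $G_\Gamma$ is uniform or contains a closed subgroup that is a free non-abelian pro-$p$ group. -/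

import Mathlib

open scoped TensorProduct DirectSum Topology

noncomputable section

namespace PRAAG

universe u

/-! ## Free pro-`p` groups of finite rank -/

/-- The normal subgroups of `p`-power index of an abstract group `Γ`. -/
def PIndex (p : ℕ) (Γ : Type u) [Group Γ] : Type u :=
  {N : Subgroup Γ // N.Normal ∧ ∃ k : ℕ, N.index = p ^ k}

instance PIndex.normal {p : ℕ} {Γ : Type u} [Group Γ] (N : PIndex p Γ) : N.1.Normal := N.2.1

/-- The finite `p`-group `Γ ⧸ N`, with the discrete topology. -/
def PQuot (p : ℕ) (Γ : Type u) [Group Γ] (N : PIndex p Γ) : Type u := Γ ⧸ N.1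

instance (p : ℕ) (Γ : Type u) [Group Γ] (N : PIndex p Γ) : Group (PQuot p Γ N) :=
  inferInstanceAs (Group (Γ ⧸ N.1))

instance (p : ℕ) (Γ : Type u) [Group Γ] (N : PIndex p Γ) : TopologicalSpace (PQuot p Γ N) := ⊥

instance (p : ℕ) (Γ : Type u) [Group Γ] (N : PIndex p Γ) : DiscreteTopology (PQuot p Γ N) := ⟨rfl⟩

/-- The projection `Γ ⧸ N → Γ ⧸ M` for `N ≤ M`. -/
def PQuot.proj {p : ℕ} {Γ : Type u} [Group Γ] {N M : PIndex p Γ} (h : N.1 ≤ M.1) :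
    PQuot p Γ N →* PQuot p Γ M :=
  QuotientGroup.map N.1 M.1 (MonoidHom.id Γ) h

/-- The pro-`p` completion of `Γ`: the inverse limit of the quotients `Γ ⧸ N` over all normal
subgroups `N` of `p`-power index, realised as a subgroup of the product. -/
def proPCompletion (p : ℕ) (Γ : Type u) [Group Γ] : Subgroup (∀ N : PIndex p Γ, PQuot p Γ N) where
  carrier := {x | ∀ (N M : PIndex p Γ) (h : N.1 ≤ M.1), PQuot.proj h (x N) = x M}
  mul_mem' := by
    intro a b ha hb N M h
    simp [ha N M h, hb N M h]
  one_mem' := by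
    intro N M h
    simp
  inv_mem' := by
    intro a ha N M h
    simp [ha N M h]

/-- The canonical map from `Γ` to its pro-`p` completion. -/
def toProP (p : ℕ) {Γ : Type u} [Group Γ] (g : Γ) : proPCompletion p Γ :=
  ⟨fun N => (QuotientGroup.mk g : Γ ⧸ N.1), fun _ _ _ => rfl⟩

/-- The free pro-`p` group on a finite set `X` (the pro-`p` completion of the free group on `X`). -/
abbrev FreeProP (p : ℕ) (X : Type u) : Type u := proPCompletion p (FreeGroup X)

/-- The generator of the free pro-`p` group attached to `x`. -/
def FreeProP.of (p : ℕ) {X : Type u} (x : X) : FreeProP p X := toProP p (FreeGroup.of x)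

/-- The power `g ^ a` of an element of a pro-`p` group by a `p`-adic integer `a`: the limit of
`g ^ aₙ`, where the natural numbers `aₙ ≡ a mod p ^ n` converge to `a`. -/
def padicPow {p : ℕ} [Fact p.Prime] {G : Type u} [Group G] [TopologicalSpace G]
    (g : G) (a : ℤ_[p]) : G :=
  haveI : Nonempty G := ⟨1⟩
  Filter.limUnder Filter.atTop (fun n : ℕ => g ^ a.appr n)

/-- The limit defining `g ^ a` exists in the pro-`p` completion of any group. -/
theorem exists_tendsto_padicPow {p : ℕ} [Fact p.Prime] {Γ : Type u} [Group Γ]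
    (g : proPCompletion p Γ) (a : ℤ_[p]) :
    ∃ l : proPCompletion p Γ,
      Filter.Tendsto (fun n : ℕ => g ^ a.appr n) Filter.atTop (𝓝 l) := by
  have key : ∀ (N : PIndex p Γ) (k : ℕ), N.1.index = p ^ k → ∀ n, k ≤ n →
      g.1 N ^ a.appr n = g.1 N ^ a.appr k := by
    intro N k hk n hn
    have h1 : g.1 N ^ (p ^ k) = 1 := by
      have hc : Nat.card (PQuot p Γ N) = p ^ k := hk
      rw [← hc]
      exact pow_card_eq_one'
    obtain ⟨c, hc⟩ := PadicInt.dvd_appr_sub_appr a k n hn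
    have h2 : a.appr n = a.appr k + p ^ k * c := by
      have := PadicInt.appr_mono a hn
      omega
    rw [h2, pow_add, pow_mul, h1, one_pow, mul_one]
  choose k hk using fun N : PIndex p Γ => N.2.2
  refine ⟨⟨fun N => g.1 N ^ a.appr (k N), ?_⟩, ?_⟩
  · intro N M h
    change PQuot.proj h (g.1 N ^ a.appr (k N)) = g.1 M ^ a.appr (k M)
    rw [map_pow, g.2 N M h, ← key M (k M) (hk M) (max (k N) (k M)) (le_max_right _ _),
      ← g.2 N M h, ← map_pow, ← map_pow, key N (k N) (hk N) _ (le_max_left _ _)]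
  · rw [tendsto_subtype_rng, tendsto_pi_nhds]
    intro N
    refine tendsto_const_nhds.congr' ?_
    filter_upwards [Filter.eventually_ge_atTop (k N)] with n hn
    exact (key N (k N) (hk N) n hn).symm

/-! ## `p`-graphs and their pro-`p` groups -/

/-- The ideal in which labels live: `p ℤ_p` for odd `p` and `4 ℤ_2` for `p = 2`. -/
def labelIdeal (p : ℕ) [Fact p.Prime] : Ideal ℤ_[p] :=
  Ideal.span {if p = 2 then (4 : ℤ_[p]) else (p : ℤ_[p])}

/-- A `p`-graph with vertex set `V`: an oriented graph without loops and without circuits of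
length two, together with a label `(f₁ e, f₂ e)` for every edge `e`. -/
structure PGraph (p : ℕ) [Fact p.Prime] (V : Type u) where
  edges : Set (V × V)
  no_loop : ∀ v : V, (v, v) ∉ edges
  no_two_circuit : ∀ v w : V, (v, w) ∈ edges → (w, v) ∉ edges
  label : edges → labelIdeal p × labelIdeal p

/-- The defining relators: for every edge `e` from `x` to `y`, the quotient of the two sides of
`[x, y] = x ^ f₁ e * y ^ f₂ e`, where `[x, y] = x⁻¹ y⁻¹ x y`. -/
def PGraph.relators {p : ℕ} [Fact p.Prime] {V : Type u} (Γ : PGraph p V) : Set (FreeProP p V) :=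
  Set.range fun e : Γ.edges =>
    let x : FreeProP p V := FreeProP.of p e.1.1
    let y : FreeProP p V := FreeProP.of p e.1.2
    (x⁻¹ * y⁻¹ * x * y) *
      (padicPow x ((Γ.label e).1 : ℤ_[p]) * padicPow y ((Γ.label e).2 : ℤ_[p]))⁻¹

/-- The closed normal subgroup generated by the defining relators. -/
def PGraph.relSubgroup {p : ℕ} [Fact p.Prime] {V : Type u} (Γ : PGraph p V) :
    Subgroup (FreeProP p V) :=
  (Subgroup.normalClosure Γ.relators).topologicalClosure

instance {p : ℕ} [Fact p.Prime] {V : Type u} (Γ : PGraph p V) : Γ.relSubgroup.Normal :=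
  Subgroup.is_normal_topologicalClosure _

/-- The generalised right angled Artin pro-`p` group (`p`-RAAG) of a `p`-graph. -/
abbrev PGraph.raag {p : ℕ} [Fact p.Prime] {V : Type u} (Γ : PGraph p V) : Type u :=
  FreeProP p V ⧸ Γ.relSubgroup

/-! ## Powerful and uniform pro-`p` groups, free subgroups -/

section Groups

variable (p : ℕ) (G : Type u) [Group G] [TopologicalSpace G] [IsTopologicalGroup G]

/-- The closed subgroup `G ^ n` generated by all `n`-th powers. -/
def powSubgroup (n : ℕ) : Subgroup G :=
  (Subgroup.closure (Set.range fun g : G => g ^ n)).topologicalClosure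

/-- Powerful pro-`p` groups: `[G, G] ≤ G ^ p` for odd `p`, and `[G, G] ≤ G ^ 4` for `p = 2`. -/
def IsPowerful : Prop :=
  (commutator G).topologicalClosure ≤ powSubgroup G (if p = 2 then 4 else p)

/-- The descending `p`-central series, indexed from `0`: `pCentral p G n` is `P_{n+1}(G)`, so
`P_1(G) = G` and `P_{i+1}(G) = P_i(G) ^ p [P_i(G), G]` (a closed subgroup). -/
def pCentral : ℕ → Subgroup G
  | 0 => ⊤
  | n + 1 => (Subgroup.closure ((fun g : G => g ^ p) '' (pCentral n : Set G)) ⊔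
      ⁅pCentral n, (⊤ : Subgroup G)⁆).topologicalClosure

/-- Uniform pro-`p` groups: topologically finitely generated, powerful, and
`|P_i(G) : P_{i+1}(G)| = |G : P_2(G)|` for all `i`. -/
def IsUniform : Prop :=
  (∃ S : Finset G, (Subgroup.closure (S : Set G)).topologicalClosure = ⊤) ∧
  IsPowerful p G ∧
  ∀ i : ℕ, (pCentral p G (i + 1)).relIndex (pCentral p G i) = (pCentral p G 1).index

/-- `G` contains a closed subgroup that is isomorphic, as a topological group, to a non-abelian free
pro-`p` group (of some finite rank `n ≥ 2`). -/
def ContainsFreeNonabelianProP : Prop :=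
  ∃ H : Subgroup G, IsClosed (H : Set G) ∧
    ∃ n : ℕ, 2 ≤ n ∧ Nonempty (H ≃ₜ* FreeProP p (Fin n))

end Groups

/-! ## The `𝔽_p`-cohomology algebra of a pro-`p` group

Continuous inhomogeneous cochains with values in the discrete trivial module `𝔽_p = ZMod p`,
with the cup product. -/

section Cohomology

set_option linter.unusedSectionVars false

variable (p : ℕ) (G : Type u) [Group G] [TopologicalSpace G]

/-- Continuous cochains `G ^ n → 𝔽_p`. -/
abbrev Cochain (n : ℕ) : Type u := LocallyConstant (Fin n → G) (ZMod p)

variable {G} [IsTopologicalGroup G]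

/-- `(g₀, …, gₙ) ↦ (g₁, …, gₙ)`. -/
def tailMap (n : ℕ) : C(Fin (n + 1) → G, Fin n → G) where
  toFun v i := v i.succ
  continuous_toFun := by fun_prop

/-- `(g₀, …, gₙ) ↦ (g₀, …, gⱼ gⱼ₊₁, …, gₙ)` for `j < n`, and `(g₀, …, gₙ) ↦ (g₀, …, gₙ₋₁)` for
`j = n`. -/
def contractMap (n : ℕ) (j : Fin (n + 1)) : C(Fin (n + 1) → G, Fin n → G) where
  toFun v := Fin.contractNth j (· * ·) v
  continuous_toFun := by
    refine continuous_pi fun k => ?_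
    unfold Fin.contractNth
    split_ifs <;> fun_prop

/-- The first `n` of `n + m` entries. -/
def headPart (n m : ℕ) : C(Fin (n + m) → G, Fin n → G) where
  toFun v i := v (Fin.castAdd m i)
  continuous_toFun := by fun_prop

/-- The last `m` of `n + m` entries. -/
def lastPart (n m : ℕ) : C(Fin (n + m) → G, Fin m → G) where
  toFun v i := v (Fin.natAdd n i)
  continuous_toFun := by fun_prop

variable (G)

/-- The differential
`(d f)(g₀, …, gₙ) = f(g₁, …, gₙ) + ∑_{j<n} (-1)^(j+1) f(g₀, …, gⱼ gⱼ₊₁, …, gₙ)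
  + (-1)^(n+1) f(g₀, …, gₙ₋₁)`. -/
def d (n : ℕ) : Cochain p G n →ₗ[ZMod p] Cochain p G (n + 1) :=
  LocallyConstant.comapₗ (ZMod p) (tailMap n) +
    ∑ j : Fin (n + 1), (-1 : ZMod p) ^ ((j : ℕ) + 1) •
      LocallyConstant.comapₗ (ZMod p) (contractMap n j)

/-- Cocycles. -/
def cocycles (n : ℕ) : Submodule (ZMod p) (Cochain p G n) := LinearMap.ker (d p G n)

/-- Coboundaries. -/
def coboundaries : (n : ℕ) → Submodule (ZMod p) (Cochain p G n)
  | 0 => ⊥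
  | n + 1 => LinearMap.range (d p G n)

/-- The continuous cohomology group `H^n(G, 𝔽_p)`. -/
abbrev Cohomology (n : ℕ) : Type u :=
  cocycles p G n ⧸ (coboundaries p G n).submoduleOf (cocycles p G n)

variable {p G}

/-- The cup product of cochains,
`(f ⌣ g)(g₁, …, gₙ₊ₘ) = f(g₁, …, gₙ) g(gₙ₊₁, …, gₙ₊ₘ)`. -/
def cup {n m : ℕ} (f : Cochain p G n) (g : Cochain p G m) : Cochain p G (n + m) :=
  f.comap (headPart n m) * g.comap (lastPart n m)

theorem cup_apply {n m : ℕ} (f : Cochain p G n) (g : Cochain p G m) (v : Fin (n + m) → G) :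
    cup f g v = f (fun i => v (Fin.castAdd m i)) * g (fun i => v (Fin.natAdd n i)) := rfl

theorem d_apply {n : ℕ} (f : Cochain p G n) (v : Fin (n + 1) → G) :
    d p G n f v = f (fun i => v i.succ) +
      ∑ j : Fin (n + 1), (-1 : ZMod p) ^ ((j : ℕ) + 1) * f (Fin.contractNth j (· * ·) v) := by
  have key : ∀ (s : Finset (Fin (n + 1))) (F : Fin (n + 1) → Cochain p G (n + 1)),
      (∑ j ∈ s, F j) v = ∑ j ∈ s, F j v := by
    intro s F
    exact map_sum (LocallyConstant.evalAddMonoidHom v) F s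
  simp only [d, LinearMap.add_apply, LinearMap.sum_apply, LinearMap.smul_apply,
    LocallyConstant.add_apply, key]
  rfl

/-- The Leibniz rule `d (f ⌣ g) = d f ⌣ g + (-1)^n f ⌣ d g`. -/
theorem d_cup_apply {n m : ℕ} (f : Cochain p G n) (g : Cochain p G m)
    (v : Fin (n + m + 1) → G) :
    d p G (n + m) (cup f g) v =
      d p G n f (fun i => v ⟨i, by omega⟩) * g (fun i => v ⟨n + 1 + i, by omega⟩) +
      (-1) ^ n * (f (fun i => v ⟨i, by omega⟩) * d p G m g (fun i => v ⟨n + i, by omega⟩)) := by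
  have e1 : ∀ j : Fin n, cup f g (Fin.contractNth (⟨j, by omega⟩ : Fin (n + m + 1)) (· * ·) v) =
      f (Fin.contractNth j.castSucc (· * ·) (fun i : Fin (n + 1) => v ⟨i, by omega⟩)) *
        g (fun i => v ⟨n + 1 + i, by omega⟩) := by
    intro j
    rw [cup_apply]
    congr 2
    · ext i
      have : ¬ (n + (i : ℕ) < j) := by omega
      have h2 : ¬ (n + (i : ℕ) = j) := by omega
      simp only [Fin.contractNth, Fin.val_natAdd, this, h2, if_false]
      congr 1
      ext
      simp
      omega
  have e2 : ∀ j : Fin (m + 1),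
      cup f g (Fin.contractNth (⟨n + j, by omega⟩ : Fin (n + m + 1)) (· * ·) v) =
      f (fun i => v ⟨i, by omega⟩) *
        g (Fin.contractNth j (· * ·) (fun i : Fin (m + 1) => v ⟨n + i, by omega⟩)) := by
    intro j
    rw [cup_apply]
    congr 2
    · ext i
      have : (i : ℕ) < n + j := by omega
      simp only [Fin.contractNth, Fin.val_castAdd, this, if_true]
      rfl
    · ext i
      simp only [Fin.contractNth, Fin.val_natAdd, Nat.add_lt_add_iff_left, Nat.add_left_cancel_iff]
      rfl
  have e0 : cup f g (fun i => v i.succ) =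
      f (fun i => v ⟨i + 1, by omega⟩) * g (fun i => v ⟨n + 1 + i, by omega⟩) := by
    rw [cup_apply]
    congr 2
    ext i
    congr 1
    ext
    simp
    omega
  have split : ∀ F : Fin (n + m + 1) → ZMod p, ∑ j, F j =
      (∑ j : Fin n, F ⟨j, by omega⟩) + ∑ j : Fin (m + 1), F ⟨n + j, by omega⟩ := by
    intro F
    exact Fin.sum_univ_add (a := n) (b := m + 1) F
  have e3 : f (Fin.contractNth (Fin.last n) (· * ·) (fun i : Fin (n + 1) => v ⟨i, by omega⟩)) =
      f (fun i => v ⟨i, by omega⟩) := by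
    congr 1
    ext i
    simp [Fin.contractNth]
  have e4 : (fun i : Fin m => v ⟨n + (i.succ : Fin (m + 1)), by omega⟩) =
      fun i : Fin m => v ⟨n + 1 + i, by omega⟩ := by
    ext i
    congr 1
    ext
    simp
    omega
  rw [d_apply, d_apply, d_apply, split, e0]
  simp only [e1, e2]
  rw [Fin.sum_univ_castSucc (n := n), e3, e4]
  simp only [Fin.val_castSucc, Fin.val_last, Fin.val_succ]
  simp only [add_mul, mul_add, Finset.sum_mul, Finset.mul_sum]
  have s1 : ∀ j : Fin (m + 1), (-1 : ZMod p) ^ (n + (j : ℕ) + 1) *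
      (f (fun i => v ⟨i, by omega⟩) *
        g (Fin.contractNth j (· * ·) (fun i : Fin (m + 1) => v ⟨n + i, by omega⟩))) =
      (-1) ^ n * (f (fun i => v ⟨i, by omega⟩) * ((-1 : ZMod p) ^ ((j : ℕ) + 1) *
        g (Fin.contractNth j (· * ·) (fun i : Fin (m + 1) => v ⟨n + i, by omega⟩)))) := by
    intro j
    ring
  rw [Finset.sum_congr rfl fun j _ => s1 j]
  simp only [mul_assoc]
  ring

theorem cup_add_left {n m : ℕ} (f f' : Cochain p G n) (g : Cochain p G m) :
    cup (f + f') g = cup f g + cup f' g := by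
  ext v
  simp [cup_apply, add_mul]

theorem cup_add_right {n m : ℕ} (f : Cochain p G n) (g g' : Cochain p G m) :
    cup f (g + g') = cup f g + cup f g' := by
  ext v
  simp [cup_apply, mul_add]

theorem cup_smul_left {n m : ℕ} (c : ZMod p) (f : Cochain p G n) (g : Cochain p G m) :
    cup (c • f) g = c • cup f g := by
  ext v
  simp [cup_apply, mul_assoc]

theorem cup_smul_right {n m : ℕ} (c : ZMod p) (f : Cochain p G n) (g : Cochain p G m) :
    cup f (c • g) = c • cup f g := by
  ext v
  simp [cup_apply, mul_left_comm]

theorem mem_coboundaries_of_eq {n k : ℕ} (h : n = k + 1) (f : Cochain p G n) (c : Cochain p G k)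
    (hf : ∀ v : Fin (k + 1) → G, f (fun i => v (Fin.cast h i)) = d p G k c v) :
    f ∈ coboundaries p G n := by
  subst h
  exact ⟨c, by ext v; exact (hf v).symm⟩

theorem cup_mem_cocycles {n m : ℕ} {f : Cochain p G n} {g : Cochain p G m}
    (hf : f ∈ cocycles p G n) (hg : g ∈ cocycles p G m) : cup f g ∈ cocycles p G (n + m) := by
  have hf' : d p G n f = 0 := hf
  have hg' : d p G m g = 0 := hg
  change d p G (n + m) (cup f g) = 0
  ext v
  rw [d_cup_apply, hf', hg']
  simp

theorem cup_mem_coboundaries_left {n m : ℕ} {f : Cochain p G n} {g : Cochain p G m}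
    (hf : f ∈ coboundaries p G n) (hg : g ∈ cocycles p G m) :
    cup f g ∈ coboundaries p G (n + m) := by
  have hg' : d p G m g = 0 := hg
  cases n with
  | zero =>
    have : f = 0 := hf
    subst this
    have : cup (0 : Cochain p G 0) g = 0 := by
      ext v
      simp [cup_apply]
    rw [this]
    exact zero_mem _
  | succ n =>
    obtain ⟨b, rfl⟩ := hf
    refine mem_coboundaries_of_eq (by omega : n + 1 + m = n + m + 1) _ (cup b g) fun v => ?_
    rw [d_cup_apply, hg', cup_apply]
    simp
    rfl

theorem cup_mem_coboundaries_right {n m : ℕ} {f : Cochain p G n} {g : Cochain p G m}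
    (hf : f ∈ cocycles p G n) (hg : g ∈ coboundaries p G m) :
    cup f g ∈ coboundaries p G (n + m) := by
  have hf' : d p G n f = 0 := hf
  cases m with
  | zero =>
    have : g = 0 := hg
    subst this
    have : cup f (0 : Cochain p G 0) = 0 := by
      ext v
      rw [cup_apply, LocallyConstant.zero_apply, mul_zero, LocallyConstant.zero_apply]
    rw [this]
    exact zero_mem _
  | succ m =>
    obtain ⟨b, rfl⟩ := hg
    refine mem_coboundaries_of_eq (rfl : n + (m + 1) = n + m + 1) _ ((-1 : ZMod p) ^ n • cup f b)
      fun v => ?_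
    have hL := d_cup_apply f b v
    rw [map_smul, LocallyConstant.smul_apply, smul_eq_mul, cup_apply]
    refine Eq.trans ?_ (congrArg (fun t => (-1 : ZMod p) ^ n * t) hL.symm)
    rw [hf']
    have h1 : ((-1 : ZMod p) ^ n) * (-1) ^ n = 1 := by
      rw [← mul_pow]
      simp
    simp only [LocallyConstant.zero_apply, zero_mul, zero_add]
    rw [← mul_assoc, h1, one_mul]
    rfl

/-- The cohomology class of a cocycle. -/
def cls {n : ℕ} (f : Cochain p G n) (hf : f ∈ cocycles p G n) : Cohomology p G n :=
  Submodule.Quotient.mk ⟨f, hf⟩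

/-- The cup product `H^n(G, 𝔽_p) × H^m(G, 𝔽_p) → H^{n+m}(G, 𝔽_p)`, `[f] ⌣ [g] = [f ⌣ g]`. -/
def cupH {n m : ℕ} :
    Cohomology p G n →ₗ[ZMod p] Cohomology p G m →ₗ[ZMod p] Cohomology p G (n + m) :=
  Submodule.liftQ _
    (LinearMap.mk₂ (ZMod p)
      (fun (f : cocycles p G n) (b : Cohomology p G m) =>
        Submodule.liftQ ((coboundaries p G m).submoduleOf (cocycles p G m))
          (Submodule.mkQ _ ∘ₗ
            ({ toFun := fun g => ⟨cup f.1 g.1, cup_mem_cocycles f.2 g.2⟩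
               map_add' := fun g g' => Subtype.ext (cup_add_right f.1 g.1 g'.1)
               map_smul' := fun c g => Subtype.ext (cup_smul_right c f.1 g.1) } :
              cocycles p G m →ₗ[ZMod p] cocycles p G (n + m)))
          (fun g hg => (Submodule.Quotient.mk_eq_zero _).2
            (cup_mem_coboundaries_right f.2 hg)) b)
      (fun f f' b => by
        obtain ⟨g, rfl⟩ := Submodule.Quotient.mk_surjective _ b
        exact congrArg Submodule.Quotient.mk (Subtype.ext (cup_add_left f.1 f'.1 g.1)))
      (fun c f b => by
        obtain ⟨g, rfl⟩ := Submodule.Quotient.mk_surjective _ b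
        exact congrArg Submodule.Quotient.mk (Subtype.ext (cup_smul_left c f.1 g.1)))
      (fun f b b' => map_add _ b b')
      (fun c f b => map_smul _ c b))
    (fun f hf => by
      refine LinearMap.mem_ker.2 (LinearMap.ext fun b => ?_)
      obtain ⟨g, rfl⟩ := Submodule.Quotient.mk_surjective _ b
      exact (Submodule.Quotient.mk_eq_zero _).2 (cup_mem_coboundaries_left hf g.2))

theorem cupH_cls {n m : ℕ} (f : Cochain p G n) (hf : f ∈ cocycles p G n) (g : Cochain p G m)
    (hg : g ∈ cocycles p G m) :
    cupH (cls f hf) (cls g hg) = cls (cup f g) (cup_mem_cocycles hf hg) := rfl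

theorem mk_cls_eq {n m : ℕ} (h : n = m) (f : Cochain p G n) (hf : f ∈ cocycles p G n)
    (g : Cochain p G m) (hg : g ∈ cocycles p G m)
    (hfg : ∀ v : Fin m → G, f (fun i => v (Fin.cast h i)) = g v) :
    (GradedMonoid.mk n (cls f hf) : GradedMonoid (Cohomology p G)) =
      GradedMonoid.mk m (cls g hg) := by
  subst h
  have : f = g := by
    ext v
    exact hfg v
  subst this
  rfl

theorem const_mem_cocycles (c : ZMod p) :
    (LocallyConstant.const (Fin 0 → G) c : Cochain p G 0) ∈ cocycles p G 0 := by
  change d p G 0 _ = 0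
  ext v
  rw [d_apply]
  simp

variable (p G) in
/-- The class in `H^0(G, 𝔽_p)` of a constant. -/
def constH : ZMod p →+ Cohomology p G 0 where
  toFun c := cls (LocallyConstant.const _ c) (const_mem_cocycles c)
  map_zero' := rfl
  map_add' _ _ := rfl

instance : GradedMonoid.GOne (Cohomology p G) := ⟨constH p G 1⟩

instance : GradedMonoid.GMul (Cohomology p G) := ⟨fun a b => cupH a b⟩

/-- The graded monoid structure on `H^•(G, 𝔽_p)` given by the cup product. -/
instance instGMonoid : GradedMonoid.GMonoid (Cohomology p G) where
  one_mul := by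
    rintro ⟨n, a⟩
    obtain ⟨⟨f, hf⟩, rfl⟩ := Submodule.Quotient.mk_surjective _ a
    refine mk_cls_eq (zero_add n) _ (cup_mem_cocycles (const_mem_cocycles 1) hf) f hf fun v => ?_
    rw [cup_apply]
    simp
  mul_one := by
    rintro ⟨n, a⟩
    obtain ⟨⟨f, hf⟩, rfl⟩ := Submodule.Quotient.mk_surjective _ a
    refine mk_cls_eq (add_zero n) _ (cup_mem_cocycles hf (const_mem_cocycles 1)) f hf fun v => ?_
    rw [cup_apply]
    simp
  mul_assoc := by
    rintro ⟨n, a⟩ ⟨m, b⟩ ⟨l, c⟩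
    obtain ⟨⟨f, hf⟩, rfl⟩ := Submodule.Quotient.mk_surjective _ a
    obtain ⟨⟨g, hg⟩, rfl⟩ := Submodule.Quotient.mk_surjective _ b
    obtain ⟨⟨h, hh⟩, rfl⟩ := Submodule.Quotient.mk_surjective _ c
    refine mk_cls_eq (add_assoc n m l) _ (cup_mem_cocycles (cup_mem_cocycles hf hg) hh) _
      (cup_mem_cocycles hf (cup_mem_cocycles hg hh)) fun v => ?_
    simp only [cup_apply]
    rw [mul_assoc]
    congr 2
    congr 1
    ext i
    congr 1
    ext
    simp
    omega

/-- The graded ring structure on `H^•(G, 𝔽_p)` given by the cup product. -/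
instance : DirectSum.GSemiring (Cohomology p G) where
  __ := (instGMonoid : GradedMonoid.GMonoid (Cohomology p G))
  mul_zero a := map_zero (cupH a)
  zero_mul b := LinearMap.map_zero₂ cupH b
  mul_add a b c := map_add (cupH a) b c
  add_mul a b c := LinearMap.map_add₂ cupH a b c
  natCast k := constH p G k
  natCast_zero := by simp
  natCast_succ k := by
    rw [Nat.cast_succ, map_add]
    rfl

/-- The `𝔽_p`-algebra structure on `H^•(G, 𝔽_p)`. -/
instance : DirectSum.GAlgebra (ZMod p) (Cohomology p G) where
  toFun := constH p G
  map_one := rfl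
  map_mul r s := by
    refine mk_cls_eq rfl _ (const_mem_cocycles (r * s)) _
      (cup_mem_cocycles (const_mem_cocycles r) (const_mem_cocycles s)) fun v => ?_
    rw [cup_apply]
    rfl
  commutes := by
    rintro r ⟨n, a⟩
    obtain ⟨⟨f, hf⟩, rfl⟩ := Submodule.Quotient.mk_surjective _ a
    refine mk_cls_eq ((zero_add n).trans (add_zero n).symm) _
      (cup_mem_cocycles (const_mem_cocycles r) hf) _
      (cup_mem_cocycles hf (const_mem_cocycles r)) fun v => ?_
    rw [cup_apply, cup_apply, mul_comm]
    simp
  smul_def := by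
    rintro r ⟨n, a⟩
    obtain ⟨⟨f, hf⟩, rfl⟩ := Submodule.Quotient.mk_surjective _ a
    refine mk_cls_eq (zero_add n).symm _ (Submodule.smul_mem _ r hf) _
      (cup_mem_cocycles (const_mem_cocycles r) hf) fun v => ?_
    rw [cup_apply]
    simp

end Cohomology

/-! ## Quadratic algebras -/

section Quadratic

variable {k : Type} {V : Type u} [Field k] [AddCommGroup V] [Module k V]

/-- The map `V ⊗ V → T(V)` onto the tensors of degree two. -/
def tensorSquare : V ⊗[k] V →ₗ[k] TensorAlgebra k V :=
  LinearMap.mul' k (TensorAlgebra k V) ∘ₗ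
    TensorProduct.map (TensorAlgebra.ι k) (TensorAlgebra.ι k)

/-- `Q(V, Ω) = T(V) / (Ω)`, the quotient of the tensor algebra by the two-sided ideal generated by
`Ω ⊆ V ⊗ V`. -/
abbrev QuadAlg (Ω : Set (V ⊗[k] V)) : Type u :=
  RingQuot fun a b : TensorAlgebra k V => b = 0 ∧ ∃ w ∈ Ω, a = tensorSquare w

/-- The degree `n` component of `Q(V, Ω)`: the image of the tensors of degree `n`. -/
def QuadAlg.component (Ω : Set (V ⊗[k] V)) (n : ℕ) : Submodule k (QuadAlg Ω) :=
  ((LinearMap.range (TensorAlgebra.ι k : V →ₗ[k] TensorAlgebra k V)) ^ n).map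
    (RingQuot.mkAlgHom k fun a b : TensorAlgebra k V =>
      b = 0 ∧ ∃ w ∈ Ω, a = tensorSquare w).toLinearMap

variable (k) in
/-- A graded algebra `A = ⨁ Aₙ` is quadratic if it is isomorphic, as a graded algebra, to
`Q(A₁, Ω)` for some `Ω ⊆ A₁ ⊗ A₁`. -/
def IsQuadraticAlgebra (A : ℕ → Type u) [∀ n, AddCommGroup (A n)] [∀ n, Module k (A n)]
    [DirectSum.GSemiring A] [DirectSum.GAlgebra k A] : Prop :=
  ∃ (Ω : Set (A 1 ⊗[k] A 1)) (e : QuadAlg Ω ≃ₐ[k] ⨁ n, A n),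
    ∀ n : ℕ, (QuadAlg.component Ω n).map e.toLinearMap = LinearMap.range (DirectSum.lof k ℕ A n)

/-- A pro-`p` group is (`H^•`-)quadratic if its `𝔽_p`-cohomology algebra is quadratic. -/
def IsHQuadratic (p : ℕ) [Fact p.Prime] (G : Type u) [Group G] [TopologicalSpace G]
    [IsTopologicalGroup G] : Prop :=
  IsQuadraticAlgebra (ZMod p) (Cohomology p G)

end Quadratic

end PRAAG

end

noncomputable section

namespace PRAAG

open scoped commutatorElement

universe u v w

/-! Let q be p for odd p and 4 for p = 2, so that q divides every label. The dichotomy is whether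
all pairs of distinct vertices are joined by an edge.

If they are, the relations put all commutators of generators into the closed subgroup of q-th
powers. Modulo it the generators commute, hence by density all elements do, and G is powerful
(`PGraph.isPowerful`).

If v and w are not joined, then v w⁻¹ and its conjugate by w generate a free pro-p group. An
assignment of vertices to elements of a finite p-group that are killed by q and commute along edges
extends to G (`PGraph.exists_hom`). Given s, t in a finite p-group P, suitable images of v and w in
the wreath product of P with the cyclic group of order q place the two words in the base group, with
s and t as their coordinates at 1 (`exists_wreath`). So every finite p-quotient of the free pro-p
group of rank 2 is detected through G (`PGraph.containsFree`).

For quadratic G only the powerful case is left. In a powerful torsion-free pro-p group the p-th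
power map identifies consecutive layers of the p-central series, so finite generation gives
uniformity (`isUniform_of_torsionFree`).

Torsion-freeness comes from cohomology. H¹ is finite and its classes have cup square zero; for p = 2
this is because labels divisible by 4 let characters lift to ℤ/4. A quadratic algebra is generated
in degree one, so here it is a quotient of the exterior algebra on H¹ and vanishes above degree dim
H¹ (`IsQuadraticAlgebra.subsingleton`). Vanishing passes to finite coefficient modules by dévissage
and to a subgroup of order p by an argument of Shapiro type (`TrivSplit.cocyclesSplit`). But a group
of order p has cohomology in every positive even degree (`not_cocyclesSplit_odd`). -/

/-- The identity has a basis of neighbourhoods consisting of open normal subgroups of `p`-power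
index. -/
def IsProP (p : ℕ) (G : Type*) [Group G] [TopologicalSpace G] : Prop :=
  ∀ U ∈ 𝓝 (1 : G), ∃ K : Subgroup G, K.Normal ∧ IsOpen (K : Set G) ∧ (∃ k : ℕ, K.index = p ^ k) ∧
    (K : Set G) ⊆ U

/-! ### Pro-`p` completions: compactness, density, functoriality -/

section Completion

variable {p : ℕ} {Γ : Type u} [Group Γ]

theorem PIndex.finite_quot [Fact p.Prime] (N : PIndex p Γ) : Finite (PQuot p Γ N) := by
  obtain ⟨k, hk⟩ := N.2.2
  have hc : Nat.card (PQuot p Γ N) = p ^ k := hk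
  apply Nat.finite_of_card_ne_zero
  rw [hc]
  exact pow_ne_zero _ (Fact.out : p.Prime).ne_zero

theorem isClosed_proPCompletion (p : ℕ) (Γ : Type u) [Group Γ] :
    IsClosed (proPCompletion p Γ : Set (∀ N : PIndex p Γ, PQuot p Γ N)) := by
  have h : (proPCompletion p Γ : Set (∀ N : PIndex p Γ, PQuot p Γ N)) =
      ⋂ (N : PIndex p Γ) (M : PIndex p Γ) (h : N.1 ≤ M.1), {x | PQuot.proj h (x N) = x M} := by
    ext x
    simp [proPCompletion]
  rw [h]
  refine isClosed_iInter fun N => isClosed_iInter fun M => isClosed_iInter fun h => ?_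
  exact isClosed_eq ((continuous_of_discreteTopology (f := PQuot.proj h)).comp
    (continuous_apply N)) (continuous_apply M)

instance [Fact p.Prime] : CompactSpace (proPCompletion p Γ) := by
  have : ∀ N : PIndex p Γ, Finite (PQuot p Γ N) := PIndex.finite_quot
  exact isCompact_iff_compactSpace.1 (isClosed_proPCompletion p Γ).isCompact

/-- The canonical homomorphism to the pro-`p` completion. -/
def toProPHom (p : ℕ) (Γ : Type u) [Group Γ] : Γ →* proPCompletion p Γ where
  toFun := toProP p
  map_one' := rfl
  map_mul' _ _ := rfl

/-- The projection of the pro-`p` completion onto a finite quotient. -/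
def proPProj (N : PIndex p Γ) : proPCompletion p Γ →* PQuot p Γ N :=
  (Pi.evalMonoidHom _ N).comp (proPCompletion p Γ).subtype

theorem continuous_proPProj (N : PIndex p Γ) : Continuous (proPProj N) :=
  (continuous_apply N).comp continuous_subtype_val

theorem proPProj_surjective (N : PIndex p Γ) : Function.Surjective (proPProj N) := by
  intro x
  obtain ⟨g, rfl⟩ := QuotientGroup.mk_surjective (s := N.1) x
  exact ⟨toProP p g, rfl⟩

theorem index_inf_eq_pow [Fact p.Prime] {G : Type*} [Group G] {N M : Subgroup G} [N.Normal]
    (hN : ∃ k : ℕ, N.index = p ^ k) (hM : ∃ k : ℕ, M.index = p ^ k) :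
    ∃ k : ℕ, (N ⊓ M).index = p ^ k := by
  obtain ⟨k, hk⟩ := hN
  obtain ⟨l, hl⟩ := hM
  have h1 : (N ⊓ M).relIndex M * M.index = (N ⊓ M).index :=
    Subgroup.relIndex_mul_index inf_le_right
  rw [Subgroup.inf_relIndex_right] at h1
  have h2 : N.relIndex M ∣ p ^ k := hk ▸ Subgroup.relIndex_dvd_index_of_normal N M
  obtain ⟨j, -, hj⟩ := (Nat.dvd_prime_pow (Fact.out : p.Prime)).1 h2
  exact ⟨j + l, by rw [← h1, hj, hl, pow_add]⟩

instance [Fact p.Prime] : Nonempty (PIndex p Γ) := ⟨⟨⊤, inferInstance, 0, by simp⟩⟩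

/-- Normal subgroups of `p`-power index are closed under finite intersection, so the finitely many
coordinates of a basic open set can be replaced by one. -/
theorem proP_nhds_basis [Fact p.Prime] (x : proPCompletion p Γ) (U : Set (proPCompletion p Γ))
    (hU : U ∈ 𝓝 x) : ∃ N : PIndex p Γ, ∀ y, proPProj N y = proPProj N x → y ∈ U := by
  classical
  have h1 : ∃ s : Finset (PIndex p Γ), ∀ y : proPCompletion p Γ,
      (∀ N ∈ s, proPProj N y = proPProj N x) → y ∈ U := by
    rw [nhds_subtype_eq_comap, Filter.mem_comap] at hU
    obtain ⟨W, hW, hWU⟩ := hU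
    rw [nhds_pi, Filter.mem_pi] at hW
    obtain ⟨I, hI, t, ht, hIt⟩ := hW
    refine ⟨hI.toFinset, fun y hy => hWU (hIt fun N hN => ?_)⟩
    have := hy N (hI.mem_toFinset.2 hN)
    change y.1 N = x.1 N at this
    rw [this]
    exact mem_of_mem_nhds (ht N)
  obtain ⟨s, hs⟩ := h1
  have h2 : ∃ N : PIndex p Γ, ∀ M ∈ s, N.1 ≤ M.1 := by
    clear hs
    induction s using Finset.induction_on with
    | empty => exact ⟨Classical.arbitrary _, by simp⟩
    | insert M s hM ih =>
      obtain ⟨N, hN⟩ := ih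
      refine ⟨⟨N.1 ⊓ M.1, inferInstance, index_inf_eq_pow N.2.2 M.2.2⟩, fun L hL => ?_⟩
      rcases Finset.mem_insert.1 hL with rfl | hL
      · exact inf_le_right
      · exact inf_le_left.trans (hN L hL)
  obtain ⟨N, hN⟩ := h2
  refine ⟨N, fun y hy => hs y fun M hM => ?_⟩
  have hx := x.2 N M (hN M hM)
  have hy' := y.2 N M (hN M hM)
  change y.1 M = x.1 M
  change y.1 N = x.1 N at hy
  rw [← hx, ← hy', hy]

theorem isProP_proPCompletion [Fact p.Prime] : IsProP p (proPCompletion p Γ) := by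
  intro U hU
  obtain ⟨N, hN⟩ := proP_nhds_basis 1 U hU
  refine ⟨(proPProj N).ker, inferInstance, ?_, ?_, ?_⟩
  · exact (isOpen_discrete ({1} : Set (PQuot p Γ N))).preimage (continuous_proPProj N)
  · obtain ⟨k, hk⟩ := N.2.2
    refine ⟨k, ?_⟩
    rw [Subgroup.index_ker, MonoidHom.range_eq_top.2 (proPProj_surjective N), ← hk]
    exact Nat.card_congr (Equiv.Set.univ _)
  · intro y hy
    exact hN y (by rw [map_one]; exact hy)

theorem denseRange_toProP [Fact p.Prime] : DenseRange (toProP p : Γ → proPCompletion p Γ) := by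
  intro x
  rw [mem_closure_iff_nhds]
  intro U hU
  obtain ⟨N, hN⟩ := proP_nhds_basis x U hU
  obtain ⟨g, hg⟩ := QuotientGroup.mk_surjective (s := N.1) (proPProj N x)
  exact ⟨toProP p g, hN _ hg, g, rfl⟩

theorem PIndex.of_hom [Fact p.Prime] {Q : Type*} [Group Q] [Finite Q] (hQ : IsPGroup p Q)
    (f : Γ →* Q) : ∃ k : ℕ, f.ker.index = p ^ k := by
  rw [Subgroup.index_ker]
  exact (hQ.to_subgroup f.range).exists_card_eq

/-- The kernel of `f` is itself one of the indices of the inverse limit, so `F` is a coordinate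
projection followed by an injection. -/
theorem exists_lift [Fact p.Prime] {Q : Type*} [Group Q] [Finite Q] [TopologicalSpace Q]
    (hQ : IsPGroup p Q) (f : Γ →* Q) :
    ∃ F : proPCompletion p Γ →* Q, Continuous F ∧ ∀ g, F (toProP p g) = f g := by
  let N : PIndex p Γ := ⟨f.ker, inferInstance, PIndex.of_hom hQ f⟩
  let φ : PQuot p Γ N →* Q := QuotientGroup.kerLift f
  refine ⟨φ.comp (proPProj N), ?_, fun g => rfl⟩
  exact (continuous_of_discreteTopology (f := φ)).comp (continuous_proPProj N)

theorem exists_map [Fact p.Prime] {Δ : Type v} [Group Δ] (f : Γ →* Δ) :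
    ∃ F : proPCompletion p Γ →* proPCompletion p Δ, Continuous F ∧
      ∀ g, F (toProP p g) = toProP p (f g) := by
  have hp : ∀ N : PIndex p Δ, ∃ F : proPCompletion p Γ →* PQuot p Δ N, Continuous F ∧
      ∀ g, F (toProP p g) = proPProj N (toProP p (f g)) := by
    intro N
    have := N.finite_quot
    have hQ : IsPGroup p (PQuot p Δ N) := by
      obtain ⟨k, hk⟩ := N.2.2
      exact IsPGroup.of_card (n := k) hk
    exact exists_lift hQ (((proPProj N).comp (toProPHom p Δ)).comp f)
  choose F hF hFg using hp
  refine ⟨(MonoidHom.pi F).codRestrict _ fun x => ?_, ?_, ?_⟩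
  · intro N M h
    change PQuot.proj h (F N x) = F M x
    have e : (fun x => PQuot.proj h (F N x)) = fun x => F M x := by
      refine denseRange_toProP.equalizer
        ((continuous_of_discreteTopology (f := PQuot.proj h)).comp (hF N)) (hF M) ?_
      ext g
      simp only [Function.comp, hFg]
      rfl
    exact congrFun e x
  · exact (continuous_pi hF).subtype_mk _
  · intro g
    apply Subtype.ext
    funext N
    exact hFg N g

end Completion

theorem IsProP.quotient {p : ℕ} [Fact p.Prime] {G : Type*} [Group G] [TopologicalSpace G]
    [IsTopologicalGroup G] (hG : IsProP p G) (R : Subgroup G) [R.Normal] : IsProP p (G ⧸ R) := by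
  intro U hU
  have hU' : (QuotientGroup.mk : G → G ⧸ R) ⁻¹' U ∈ 𝓝 (1 : G) :=
    QuotientGroup.continuous_mk.continuousAt.preimage_mem_nhds hU
  obtain ⟨K, hK, hKo, ⟨k, hk⟩, hKU⟩ := hG _ hU'
  refine ⟨K.map (QuotientGroup.mk' R), hK.map _ (QuotientGroup.mk'_surjective R), ?_, ?_, ?_⟩
  · exact QuotientGroup.isOpenMap_coe _ hKo
  · have h := Subgroup.index_map_dvd (H := K) (f := QuotientGroup.mk' R)
      (QuotientGroup.mk'_surjective R)
    rw [hk] at h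
    obtain ⟨j, -, hj⟩ := (Nat.dvd_prime_pow (Fact.out : p.Prime)).1 h
    exact ⟨j, hj⟩
  · rintro _ ⟨x, hx, rfl⟩
    exact hKU hx

theorem dense_closure_range_of (p : ℕ) [Fact p.Prime] (X : Type u) :
    Dense (Subgroup.closure (Set.range (FreeProP.of p : X → FreeProP p X)) :
      Set (FreeProP p X)) := by
  have h : Set.range (toProP p : FreeGroup X → FreeProP p X) ⊆
      (Subgroup.closure (Set.range (FreeProP.of p : X → FreeProP p X))) := by
    rintro _ ⟨g, rfl⟩
    change toProPHom p _ g ∈ _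
    have hg : g ∈ Subgroup.closure (Set.range (FreeGroup.of : X → FreeGroup X)) := by
      rw [FreeGroup.closure_range_of]; trivial
    induction hg using Subgroup.closure_induction with
    | mem x hx =>
      obtain ⟨y, rfl⟩ := hx
      exact Subgroup.subset_closure ⟨y, rfl⟩
    | one => rw [map_one]; exact one_mem _
    | mul x y _ _ hx hy => rw [map_mul]; exact mul_mem hx hy
    | inv x _ hx => rw [map_inv]; exact inv_mem hx
  exact denseRange_toProP.mono h

/-! ### Labels and `p`-adic powers -/

/-- The exponent `p` for odd `p` and `4` for `p = 2`. -/
abbrev labelPow (p : ℕ) : ℕ := if p = 2 then 4 else p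

theorem exists_labelPow_eq (p : ℕ) : ∃ k, labelPow p = p ^ k := by
  by_cases h : p = 2
  · exact ⟨2, by simp [labelPow, h]⟩
  · exact ⟨1, by simp [labelPow, h]⟩

/-- This transfers divisibility of the label to the natural exponents in the limit defining
`padicPow`. Hence a label power is a limit of q-th powers, and dies wherever q-th powers of the base
die. -/
theorem labelPow_dvd_appr {p : ℕ} [Fact p.Prime] (a : labelIdeal p) :
    ∀ᶠ n in Filter.atTop, labelPow p ∣ (a : ℤ_[p]).appr n := by
  obtain ⟨k, hk⟩ := exists_labelPow_eq p
  have ha : ((p : ℤ_[p]) ^ k) ∣ (a : ℤ_[p]) := by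
    have h := Ideal.mem_span_singleton.1 a.2
    have e : (if p = 2 then (4 : ℤ_[p]) else (p : ℤ_[p])) = (p : ℤ_[p]) ^ k := by
      have : ((labelPow p : ℕ) : ℤ_[p]) = ((p ^ k : ℕ) : ℤ_[p]) := by rw [hk]
      rw [Nat.cast_pow] at this
      rw [← this]
      split_ifs with h2 <;> simp
    rwa [e] at h
  filter_upwards [Filter.eventually_ge_atTop k] with n hn
  have h1 := PadicInt.appr_spec n (a : ℤ_[p])
  rw [Ideal.mem_span_singleton] at h1
  have h2 : ((p : ℤ_[p]) ^ k) ∣ (((a : ℤ_[p]).appr n : ℤ) : ℤ_[p]) := by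
    have h3 := dvd_sub ha ((pow_dvd_pow _ hn).trans h1)
    simpa using h3
  rw [PadicInt.pow_p_dvd_int_iff] at h2
  rw [hk]
  exact_mod_cast h2

theorem tendsto_padicPow {p : ℕ} [Fact p.Prime] {Γ : Type u} [Group Γ]
    (g : proPCompletion p Γ) (a : ℤ_[p]) :
    Filter.Tendsto (fun n : ℕ => g ^ a.appr n) Filter.atTop (𝓝 (padicPow g a)) := by
  obtain ⟨l, hl⟩ := exists_tendsto_padicPow g a
  have : padicPow g a = l := hl.limUnder_eq
  rwa [this]

theorem map_padicPow_eq_one {p : ℕ} [Fact p.Prime] {Γ : Type u} [Group Γ] {Q : Type*} [Group Q]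
    [TopologicalSpace Q] [T2Space Q] (F : proPCompletion p Γ →* Q) (hF : Continuous F)
    (g : proPCompletion p Γ) (hg : F g ^ labelPow p = 1) (a : labelIdeal p) :
    F (padicPow g (a : ℤ_[p])) = 1 := by
  have h1 := (hF.tendsto _).comp (tendsto_padicPow g (a : ℤ_[p]))
  refine tendsto_nhds_unique h1 (tendsto_const_nhds.congr' ?_)
  filter_upwards [labelPow_dvd_appr a] with n hn
  obtain ⟨c, hc⟩ := hn
  simp only [Function.comp, map_pow]
  rw [hc, pow_mul, hg, one_pow]

theorem padicPow_mem_powSubgroup {p : ℕ} [Fact p.Prime] {Γ : Type u} [Group Γ]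
    {Q : Type*} [Group Q] [TopologicalSpace Q] [IsTopologicalGroup Q]
    (F : proPCompletion p Γ →* Q) (hF : Continuous F) (g : proPCompletion p Γ)
    (a : labelIdeal p) : F (padicPow g (a : ℤ_[p])) ∈ powSubgroup Q (labelPow p) := by
  have h1 := (hF.tendsto _).comp (tendsto_padicPow g (a : ℤ_[p]))
  refine (Subgroup.isClosed_topologicalClosure _).mem_of_tendsto h1 ?_
  filter_upwards [labelPow_dvd_appr a] with n hn
  obtain ⟨c, hc⟩ := hn
  refine Subgroup.le_topologicalClosure _ (Subgroup.subset_closure ⟨F g ^ c, ?_⟩)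
  simp only [Function.comp, map_pow]
  rw [hc, mul_comm, pow_mul]

/-! ### Generators, relations and finite quotients of a `p`-RAAG -/

namespace PGraph

variable {p : ℕ} [Fact p.Prime] {V : Type u} (Γ : PGraph p V)

/-- The projection from the free pro-`p` group. -/
def proj : FreeProP p V →* Γ.raag := QuotientGroup.mk' Γ.relSubgroup

theorem continuous_proj : Continuous Γ.proj := QuotientGroup.continuous_mk

theorem proj_surjective : Function.Surjective Γ.proj := QuotientGroup.mk'_surjective _

/-- The generator attached to a vertex. -/
def gen (v : V) : Γ.raag := Γ.proj (FreeProP.of p v)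

instance : T2Space Γ.raag := by
  have : IsClosed (Γ.relSubgroup : Set (FreeProP p V)) := Subgroup.isClosed_topologicalClosure _
  have : T3Space (FreeProP p V ⧸ Γ.relSubgroup) := inferInstance
  infer_instance

instance : CompactSpace Γ.raag := inferInstanceAs (CompactSpace (FreeProP p V ⧸ Γ.relSubgroup))

theorem isProP_raag : IsProP p Γ.raag := isProP_proPCompletion.quotient _

theorem dense_closure_range_gen :
    Dense (Subgroup.closure (Set.range Γ.gen) : Set Γ.raag) := by
  have h := (dense_closure_range_of p V)
  have h1 : (Subgroup.closure (Set.range Γ.gen) : Set Γ.raag) =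
      Γ.proj '' (Subgroup.closure (Set.range (FreeProP.of p : V → FreeProP p V))) := by
    rw [← Subgroup.coe_map, MonoidHom.map_closure, ← Set.range_comp]
    rfl
  rw [h1]
  exact Γ.proj_surjective.denseRange.dense_image Γ.continuous_proj h

theorem gen_relation (e : Γ.edges) :
    (Γ.gen e.1.1)⁻¹ * (Γ.gen e.1.2)⁻¹ * Γ.gen e.1.1 * Γ.gen e.1.2 =
      Γ.proj (padicPow (FreeProP.of p e.1.1) ((Γ.label e).1 : ℤ_[p])) *
        Γ.proj (padicPow (FreeProP.of p e.1.2) ((Γ.label e).2 : ℤ_[p])) := by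
  have h : (FreeProP.of p e.1.1)⁻¹ * (FreeProP.of p e.1.2)⁻¹ * FreeProP.of p e.1.1 *
      FreeProP.of p e.1.2 * (padicPow (FreeProP.of p e.1.1) ((Γ.label e).1 : ℤ_[p]) *
        padicPow (FreeProP.of p e.1.2) ((Γ.label e).2 : ℤ_[p]))⁻¹ ∈ Γ.relSubgroup :=
    Subgroup.le_topologicalClosure _ (Subgroup.subset_normalClosure ⟨e, rfl⟩)
  have h2 : Γ.proj _ = 1 := (QuotientGroup.eq_one_iff _).2 h
  rw [map_mul, map_inv, mul_inv_eq_one] at h2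
  simpa [gen] using h2

/-- Both sides of each relation become trivial: the commutator by `hc`, the label powers by `ha`. -/
theorem exists_hom {Q : Type v} [Group Q] [Finite Q] [TopologicalSpace Q] [DiscreteTopology Q]
    (hQ : IsPGroup p Q) (a : V → Q) (ha : ∀ x, a x ^ labelPow p = 1)
    (hc : ∀ e ∈ Γ.edges, Commute (a e.1) (a e.2)) :
    ∃ F : Γ.raag →* Q, Continuous F ∧ ∀ x, F (Γ.gen x) = a x := by
  obtain ⟨F, hF, hFa⟩ := exists_lift hQ (FreeGroup.lift a)
  have hof : ∀ x, F (FreeProP.of p x) = a x := fun x => by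
    rw [FreeProP.of, hFa, FreeGroup.lift_apply_of]
  have hle : Γ.relSubgroup ≤ F.ker := by
    refine Subgroup.topologicalClosure_minimal _ (Subgroup.normalClosure_le_normal ?_) ?_
    · rintro _ ⟨e, rfl⟩
      have h1 := map_padicPow_eq_one F hF (FreeProP.of p e.1.1) (by rw [hof, ha]) (Γ.label e).1
      have h2 := map_padicPow_eq_one F hF (FreeProP.of p e.1.2) (by rw [hof, ha]) (Γ.label e).2
      change F _ = 1
      simp only [map_mul, map_inv, h1, h2, hof]
      have := (hc e.1 e.2).eq
      rw [mul_one, inv_one, mul_one, mul_assoc, this]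
      group
    · exact isClosed_singleton.preimage hF
  refine ⟨QuotientGroup.lift _ F hle, ?_, hof⟩
  exact continuous_quot_lift _ hF

end PGraph

/-! ### A free pro-`p` subgroup from two unjoined vertices -/

/-- In a suitable finite `p`-group there are two elements `a`, `b` of order dividing `labelPow p`
such that
`a b⁻¹ ↦ s` and `b (a b⁻¹) b⁻¹ ↦ t` extends to a homomorphism from a subgroup to `P`, given here by
its graph `R`. -/
theorem exists_wreath {p : ℕ} [Fact p.Prime] {P : Type} [Group P] [Finite P] (hP : IsPGroup p P)
    (s t : P) : ∃ (Q : Type) (_ : Group Q) (_ : Finite Q) (a b : Q) (R : Subgroup (Q × P)),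
      IsPGroup p Q ∧ a ^ labelPow p = 1 ∧ b ^ labelPow p = 1 ∧ (∀ y, (1, y) ∈ R → y = 1) ∧
      (a * b⁻¹, s) ∈ R ∧ (b * (a * b⁻¹) * b⁻¹, t) ∈ R := by
  classical
  have hp : p.Prime := Fact.out
  set q := labelPow p with hq
  -- The positions 1, c⁻¹, c⁻² below must be distinct. For p = 2 this is where 4 is needed: two
  -- involutions generate only a dihedral group.
  have hq3 : 3 ≤ q := by
    rw [hq]
    unfold labelPow
    split_ifs with h
    · omega
    · have := hp.two_le
      omega
  have : NeZero q := ⟨by omega⟩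
  let C := Multiplicative (ZMod q)
  have : Finite C := inferInstanceAs (Finite (ZMod q))
  let c : C := Multiplicative.ofAdd 1
  have hcard : Nat.card C = q := (Nat.card_congr Multiplicative.toAdd).trans (Nat.card_zmod q)
  have hcq : c ^ q = 1 := by
    have h : c ^ Nat.card C = 1 := pow_card_eq_one'
    rwa [hcard] at h
  have h1 : c⁻¹ ≠ 1 := by
    intro h
    rw [inv_eq_one] at h
    have := congrArg Multiplicative.toAdd h
    have h2 : ((1 : ℕ) : ZMod q) = 0 := by simpa [c] using this
    rw [ZMod.natCast_eq_zero_iff] at h2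
    exact absurd (Nat.le_of_dvd (by norm_num) h2) (by omega)
  have h2 : c⁻¹ * c⁻¹ ≠ 1 := by
    intro h
    rw [← mul_inv, inv_eq_one] at h
    have := congrArg Multiplicative.toAdd h
    have h2 : ((2 : ℕ) : ZMod q) = 0 := by
      have h3 : (1 : ZMod q) + 1 = 0 := this
      rw [← h3]; norm_num
    rw [ZMod.natCast_eq_zero_iff] at h2
    exact absurd (Nat.le_of_dvd (by norm_num) h2) (by omega)
  have h3 : c⁻¹ * c⁻¹ ≠ c⁻¹ := by
    intro h
    exact h1 (mul_eq_left.1 h)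
  -- With `a = x b x⁻¹`, the element `a b⁻¹` lies in the base and has coordinate ξ(y) ξ(c⁻¹y)⁻¹ at
  -- y. Conjugation by `b` moves coordinate c⁻¹ to 1. So the values ξ(1) = s, ξ(c⁻¹) = 1, ξ(c⁻²) =
  -- t⁻¹ produce s and t at 1.
  let ξ : C → P := fun y => if y = 1 then s else if y = c⁻¹ * c⁻¹ then t⁻¹ else 1
  let b : RegularWreathProduct P C := ⟨1, c⟩
  let x : RegularWreathProduct P C := ⟨ξ, 1⟩
  have hbn : ∀ n : ℕ, b ^ n = ⟨1, c ^ n⟩ := by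
    intro n
    induction n with
    | zero => simp only [pow_zero]; rfl
    | succ n ih =>
      rw [pow_succ, ih, RegularWreathProduct.mul_def]
      ext <;> simp [b, pow_succ]
  have hbq : b ^ q = 1 := by rw [hbn, hcq]; rfl
  -- The graph of evaluation at 1, a homomorphism on the base group.
  let R : Subgroup (RegularWreathProduct P C × P) :=
    { carrier := {z | z.1.right = 1 ∧ z.1.left 1 = z.2}
      one_mem' := ⟨rfl, rfl⟩
      mul_mem' := by
        rintro z w ⟨hz, hz'⟩ ⟨hw, hw'⟩
        simp [RegularWreathProduct.mul_def, hz, hz', hw, hw']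
      inv_mem' := by
        rintro z ⟨hz, hz'⟩
        simp [hz, hz'] }
  refine ⟨RegularWreathProduct P C, inferInstance, inferInstance, x * b * x⁻¹, b, R, ?_, ?_, hbq,
    fun y hy => hy.2.symm, ⟨?_, ?_⟩, ?_, ?_⟩
  · obtain ⟨k, hk⟩ := hP.exists_card_eq
    obtain ⟨l, hl⟩ := exists_labelPow_eq p
    refine IsPGroup.of_card (n := k * q + l) ?_
    rw [RegularWreathProduct.card, hk, hcard, pow_add, pow_mul, ← hl]
  · rw [conj_pow, hbq]; simp
  · change (x * b * x⁻¹ * b⁻¹).right = 1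
    simp [RegularWreathProduct.mul_def, x, b]
  · change (x * b * x⁻¹ * b⁻¹).left 1 = s
    simp [RegularWreathProduct.mul_def, x, b, ξ, h1, h1.symm]
  · change (b * (x * b * x⁻¹ * b⁻¹) * b⁻¹).right = 1
    simp [RegularWreathProduct.mul_def, x, b]
  · change (b * (x * b * x⁻¹ * b⁻¹) * b⁻¹).left 1 = t
    simp [RegularWreathProduct.mul_def, x, b, ξ, h1, h1.symm, h2]

theorem eqOn_of_dense {G : Type*} [Group G] [TopologicalSpace G] {S : Set G}
    (hS : Dense (Subgroup.closure S : Set G)) (H : Subgroup G) (hH : IsClosed (H : Set G))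
    (h : S ⊆ H) : H = ⊤ := by
  rw [Subgroup.eq_top_iff']
  intro x
  have : closure (Subgroup.closure S : Set G) ⊆ H :=
    closure_minimal ((Subgroup.closure_le H).2 h) hH
  exact this (hS x)

theorem PGraph.containsFree {p : ℕ} [Fact p.Prime] {V : Type u} (Γ : PGraph p V) (v w : V)
    (hvw : v ≠ w) (h1 : (v, w) ∉ Γ.edges) (h2 : (w, v) ∉ Γ.edges) :
    ContainsFreeNonabelianProP p Γ.raag := by
  classical
  let word : Fin 2 → FreeGroup V := ![FreeGroup.of v * (FreeGroup.of w)⁻¹,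
    FreeGroup.of w * (FreeGroup.of v * (FreeGroup.of w)⁻¹) * (FreeGroup.of w)⁻¹]
  obtain ⟨φ₀, hφ₀, hφ₀w⟩ := exists_map (p := p) (FreeGroup.lift word)
  let φ : FreeProP p (Fin 2) →* Γ.raag := Γ.proj.comp φ₀
  have hφ : Continuous φ := Γ.continuous_proj.comp hφ₀
  have hof : ∀ i, φ (FreeProP.of p i) = Γ.proj (toProPHom p _ (word i)) := by
    intro i
    change Γ.proj (φ₀ _) = _
    rw [FreeProP.of, hφ₀w, FreeGroup.lift_apply_of]
    rfl
  have hof0 : φ (FreeProP.of p 0) = Γ.gen v * (Γ.gen w)⁻¹ := by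
    rw [hof]
    simp only [word, Matrix.cons_val_zero, map_mul, map_inv]
    rfl
  have hof1 : φ (FreeProP.of p 1) = Γ.gen w * (Γ.gen v * (Γ.gen w)⁻¹) * (Γ.gen w)⁻¹ := by
    rw [hof]
    simp only [word, Matrix.cons_val_one]
    rfl
  -- It suffices to see that an element of the kernel is trivial in each finite quotient `P` of the
  -- free group; the wreath product for `P` recovers that coordinate from the image in G.
  have hinj : Function.Injective φ := by
    rw [injective_iff_map_eq_one]
    intro x hx
    apply Subtype.ext
    funext N
    change proPProj N x = 1
    have := N.finite_quot
    have hP : IsPGroup p (PQuot p _ N) := by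
      obtain ⟨k, hk⟩ := N.2.2
      exact IsPGroup.of_card (n := k) hk
    obtain ⟨Q, _, _, a, b, R, hQ, ha, hb, hR, h0, h1⟩ :=
      exists_wreath hP (proPProj N (FreeProP.of p 0)) (proPProj N (FreeProP.of p 1))
    let _ : TopologicalSpace Q := ⊥
    have : DiscreteTopology Q := ⟨rfl⟩
    obtain ⟨F, hF, hFa⟩ := Γ.exists_hom hQ (fun y => if y = v then a else if y = w then b else 1)
      (by
        intro y
        split_ifs <;> simp [ha, hb])
      (by
        rintro ⟨y, z⟩ he
        dsimp only
        by_cases hy : y = v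
        · by_cases hz : z = v
          · simp [hy, hz]
          · by_cases hz' : z = w
            · subst hy hz'; contradiction
            · simp [hz, hz']
        · by_cases hy' : y = w
          · by_cases hz : z = v
            · subst hy' hz; contradiction
            · by_cases hz' : z = w
              · simp [hy', hz']
              · simp [hz, hz']
          · simp [hy, hy'])
    have hFv : F (Γ.gen v) = a := by rw [hFa]; simp
    have hFw : F (Γ.gen w) = b := by rw [hFa]; simp [hvw.symm]
    let Θ : FreeProP p (Fin 2) →* Q := F.comp φ
    have hΘ : Continuous Θ := hF.comp hφ
    -- The relation `R` holds on the two generators, and it cuts out a closed subgroup, so it holds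
    -- everywhere.
    have hH : R.comap (Θ.prod (proPProj N)) = ⊤ := by
      refine eqOn_of_dense (dense_closure_range_of p (Fin 2)) _ ?_ ?_
      · exact (isClosed_discrete (R : Set (Q × PQuot p _ N))).preimage
          (hΘ.prodMk (continuous_proPProj N))
      · rintro _ ⟨i, rfl⟩
        fin_cases i
        · have e : Θ (FreeProP.of p 0) = a * b⁻¹ := by
            change F (φ _) = _
            rw [hof0, map_mul, map_inv, hFv, hFw]
          change (Θ (FreeProP.of p 0), _) ∈ R
          rw [e]
          exact h0
        · have e : Θ (FreeProP.of p 1) = b * (a * b⁻¹) * b⁻¹ := by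
            change F (φ _) = _
            rw [hof1]
            simp only [map_mul, map_inv, hFv, hFw]
          change (Θ (FreeProP.of p 1), _) ∈ R
          rw [e]
          exact h1
    have hxR : (F (φ x), proPProj N x) ∈ R := by
      have : x ∈ R.comap (Θ.prod (proPProj N)) := by rw [hH]; trivial
      exact this
    rw [hx, map_one] at hxR
    exact hR _ hxR
  have hcl : IsClosed (φ.range : Set Γ.raag) := by
    rw [MonoidHom.coe_range]
    exact (isCompact_range hφ).isClosed
  let e : FreeProP p (Fin 2) ≃* φ.range := φ.ofInjective hinj
  have he : Continuous e := hφ.subtype_mk _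
  let e' : FreeProP p (Fin 2) ≃ₜ* φ.range :=
    { e with
      continuous_toFun := he
      continuous_invFun := (he.homeoOfEquivCompactToT2 (f := e.toEquiv)).symm.continuous }
  exact ⟨φ.range, hcl, 2, le_rfl, ⟨e'.symm⟩⟩

/-! ### Complete graphs give powerful groups -/

theorem normal_closure_of_conj_mem {G : Type*} [Group G] {S : Set G}
    (h : ∀ x ∈ S, ∀ g : G, g * x * g⁻¹ ∈ S) : (Subgroup.closure S).Normal := by
  have : Subgroup.normalClosure S = Subgroup.closure S := by
    refine le_antisymm ((Subgroup.closure_le _).2 fun x hx => ?_)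
      Subgroup.closure_le_normalClosure
    obtain ⟨a, ha, hax⟩ := Group.mem_conjugatesOfSet_iff.1 hx
    obtain ⟨g, rfl⟩ := isConj_iff.1 hax
    exact Subgroup.subset_closure (h a ha g)
  exact this ▸ Subgroup.normalClosure_normal

theorem powSubgroup_normal (G : Type u) [Group G] [TopologicalSpace G] [IsTopologicalGroup G]
    (n : ℕ) : (powSubgroup G n).Normal := by
  have : (Subgroup.closure (Set.range fun g : G => g ^ n)).Normal := by
    refine normal_closure_of_conj_mem ?_
    rintro _ ⟨x, rfl⟩ g
    exact ⟨g * x * g⁻¹, by simp [conj_pow]⟩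
  exact Subgroup.is_normal_topologicalClosure _

theorem PGraph.isPowerful {p : ℕ} [Fact p.Prime] {V : Type u} (Γ : PGraph p V)
    (h : ∀ v w, v ≠ w → (v, w) ∈ Γ.edges ∨ (w, v) ∈ Γ.edges) : IsPowerful p Γ.raag := by
  set P := powSubgroup Γ.raag (labelPow p) with hP
  have hPn : P.Normal := powSubgroup_normal _ _
  have hPc : IsClosed (P : Set Γ.raag) := Subgroup.isClosed_topologicalClosure _
  have hedge : ∀ v w, (v, w) ∈ Γ.edges →
      Commute (QuotientGroup.mk' P (Γ.gen v)) (QuotientGroup.mk' P (Γ.gen w)) := by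
    intro v w he
    have h1 := Γ.gen_relation ⟨(v, w), he⟩
    have h2 : (Γ.gen v)⁻¹ * (Γ.gen w)⁻¹ * Γ.gen v * Γ.gen w ∈ P := by
      rw [h1]
      exact mul_mem (padicPow_mem_powSubgroup Γ.proj Γ.continuous_proj _ _)
        (padicPow_mem_powSubgroup Γ.proj Γ.continuous_proj _ _)
    have h3 : QuotientGroup.mk' P ((Γ.gen v)⁻¹ * (Γ.gen w)⁻¹ * Γ.gen v * Γ.gen w) = 1 :=
      (QuotientGroup.eq_one_iff _).2 h2
    simp only [map_mul, map_inv] at h3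
    rw [mul_assoc, ← mul_inv_rev, inv_mul_eq_one] at h3
    exact h3.symm
  have hgen : ∀ v w, Commute (QuotientGroup.mk' P (Γ.gen v)) (QuotientGroup.mk' P (Γ.gen w)) := by
    intro v w
    by_cases hvw : v = w
    · rw [hvw]
    · rcases h v w hvw with h1 | h1
      · exact hedge v w h1
      · exact (hedge w v h1).symm
  have hcl : ∀ g : Γ.raag, IsClosed
      (((Subgroup.centralizer {QuotientGroup.mk' P g}).comap (QuotientGroup.mk' P) :
        Subgroup Γ.raag) : Set Γ.raag) := by
    intro g
    have : IsClosed ((fun x => x * g * x⁻¹ * g⁻¹) ⁻¹' (P : Set Γ.raag)) :=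
      hPc.preimage (by fun_prop)
    convert this using 1
    ext x
    simp only [Subgroup.coe_comap, Set.mem_preimage, SetLike.mem_coe,
      Subgroup.mem_centralizer_singleton_iff]
    rw [← QuotientGroup.eq_one_iff (N := P)]
    change _ ↔ QuotientGroup.mk' P _ = 1
    simp only [map_mul, map_inv]
    rw [mul_inv_eq_one, mul_inv_eq_iff_eq_mul]
  have key : ∀ g : Γ.raag, (∀ v, Commute (QuotientGroup.mk' P (Γ.gen v)) (QuotientGroup.mk' P g)) →
      ∀ x, Commute (QuotientGroup.mk' P x) (QuotientGroup.mk' P g) := by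
    intro g hg x
    have h1 := eqOn_of_dense Γ.dense_closure_range_gen _ (hcl g) (by
      rintro _ ⟨v, rfl⟩
      exact Subgroup.mem_centralizer_singleton_iff.2 (hg v).eq)
    have h2 : x ∈ (Subgroup.centralizer {QuotientGroup.mk' P g}).comap (QuotientGroup.mk' P) := by
      rw [h1]; trivial
    exact Subgroup.mem_centralizer_singleton_iff.1 h2
  -- Density is used in each variable: from generators to one arbitrary entry, then to both.
  have hall : ∀ x y, Commute (QuotientGroup.mk' P x) (QuotientGroup.mk' P y) := fun x y =>
    key y (fun v => (key (Γ.gen v) (fun w => hgen w v) y).symm) x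
  refine Subgroup.topologicalClosure_minimal _ ?_ hPc
  rw [commutator_def, Subgroup.commutator_le]
  intro x _ y _
  rw [← QuotientGroup.eq_one_iff (N := P)]
  change QuotientGroup.mk' P ⁅x, y⁆ = 1
  rw [map_commutatorElement, commutatorElement_eq_one_iff_commute]
  exact hall x y

/-! ### Powerful pro-`p` groups and the descending `p`-central series -/

/-- `(x y) ^ n = x ^ n y ^ n c ^ (n choose 2)` if `c = y⁻¹ x⁻¹ y x` commutes with `x` and `y`. -/
theorem mul_pow_of_commute {G : Type*} [Group G] {x y c : G} (hc : y * x = x * y * c)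
    (hx : Commute c x) (hy : Commute c y) (n : ℕ) :
    (x * y) ^ n = x ^ n * y ^ n * c ^ n.choose 2 := by
  have h1 : ∀ n : ℕ, y ^ n * x = x * y ^ n * c ^ n := by
    intro n
    induction n with
    | zero => simp
    | succ n ih =>
      calc y ^ (n + 1) * x = y ^ n * (y * x) := by rw [pow_succ]; group
        _ = (y ^ n * x) * y * c := by rw [hc]; group
        _ = x * y ^ n * (c ^ n * y) * c := by rw [ih]; group
        _ = x * y ^ (n + 1) * c ^ (n + 1) := by
          rw [(hy.pow_left n).eq]; group
  induction n with
  | zero => simp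
  | succ n ih =>
    have hx' := (hx.pow_left (n.choose 2)).eq
    have hy' := (hy.pow_left (n + n.choose 2)).eq
    calc (x * y) ^ (n + 1) = x ^ n * y ^ n * (c ^ n.choose 2 * x) * y := by
          rw [pow_succ, ih]; group
      _ = x ^ n * (y ^ n * x) * c ^ n.choose 2 * y := by rw [hx']; group
      _ = x ^ n * x * y ^ n * (c ^ (n + n.choose 2) * y) := by rw [h1, pow_add]; group
      _ = x ^ (n + 1) * y ^ (n + 1) * c ^ (n + 1).choose 2 := by
          rw [hy', Nat.choose_succ_succ' n 1, Nat.choose_one_right, pow_succ x, pow_succ y]; group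

/-- Since [x², y] = x [x, y] x⁻¹ [x, y], the hypotheses reduce it to [x, y]² = 1. -/
theorem commute_sq_of_commute {G : Type*} [Group G] {x y : G} (h1 : Commute ⁅x, y⁆ x)
    (h2 : ⁅x, y⁆ ^ 2 = 1) : Commute (x ^ 2) y := by
  have h3 : ⁅x, y⁆ * y * x = x * y := by rw [commutatorElement_def]; group
  symm
  calc y * x ^ 2 = ⁅x, y⁆ ^ 2 * y * x ^ 2 := by rw [h2, one_mul]
    _ = ⁅x, y⁆ * (⁅x, y⁆ * y * x) * x := by simp only [pow_two, mul_assoc]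
    _ = (⁅x, y⁆ * x) * y * x := by rw [h3]; simp only [mul_assoc]
    _ = x * (⁅x, y⁆ * y * x) := by rw [h1.eq]; simp only [mul_assoc]
    _ = x ^ 2 * y := by rw [h3, pow_two, mul_assoc]

section Central

variable {p : ℕ} {G : Type u} [Group G] [TopologicalSpace G] [IsTopologicalGroup G]

instance pCentral_normal (i : ℕ) : (pCentral p G i).Normal := by
  induction i with
  | zero => exact Subgroup.normal_of_characteristic (⊤ : Subgroup G)
  | succ i ih =>
    have : (Subgroup.closure ((fun g : G => g ^ p) '' (pCentral p G i : Set G))).Normal := by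
      refine normal_closure_of_conj_mem ?_
      rintro _ ⟨x, hx, rfl⟩ g
      exact ⟨g * x * g⁻¹, ih.conj_mem x hx g, by simp [conj_pow]⟩
    exact Subgroup.is_normal_topologicalClosure _

theorem isClosed_pCentral (i : ℕ) : IsClosed (pCentral p G i : Set G) := by
  cases i with
  | zero => exact isClosed_univ
  | succ i => exact Subgroup.isClosed_topologicalClosure _

theorem pow_mem_pCentral {i : ℕ} {x : G} (hx : x ∈ pCentral p G i) :
    x ^ p ∈ pCentral p G (i + 1) :=
  Subgroup.le_topologicalClosure _
    ((le_sup_left : _ ≤ _ ⊔ ⁅pCentral p G i, (⊤ : Subgroup G)⁆)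
      (Subgroup.subset_closure ⟨x, hx, rfl⟩))

theorem commutator_mem_pCentral {i : ℕ} {x : G} (hx : x ∈ pCentral p G i) (g : G) :
    ⁅x, g⁆ ∈ pCentral p G (i + 1) :=
  Subgroup.le_topologicalClosure _
    ((le_sup_right : ⁅pCentral p G i, (⊤ : Subgroup G)⁆ ≤ _)
      (Subgroup.commutator_mem_commutator hx trivial))

theorem pCentral_succ_le_of {i : ℕ} {H : Subgroup G} (hH : IsClosed (H : Set G))
    (h1 : ∀ x ∈ pCentral p G i, x ^ p ∈ H) (h2 : ∀ x ∈ pCentral p G i, ∀ g, ⁅x, g⁆ ∈ H) :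
    pCentral p G (i + 1) ≤ H := by
  refine Subgroup.topologicalClosure_minimal _ (sup_le ?_ ?_) hH
  · rw [Subgroup.closure_le]
    rintro _ ⟨x, hx, rfl⟩
    exact h1 x hx
  · rw [Subgroup.commutator_le]
    exact fun x hx g _ => h2 x hx g

theorem pCentral_succ_le (i : ℕ) : pCentral p G (i + 1) ≤ pCentral p G i :=
  pCentral_succ_le_of (isClosed_pCentral i) (fun _ hx => pow_mem hx p) fun x hx g => by
    rw [commutatorElement_def, mul_assoc, mul_assoc]
    refine mul_mem hx ?_
    rw [← mul_assoc]
    exact (pCentral_normal i).conj_mem _ (inv_mem hx) g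

theorem pCentral_antitone : Antitone (pCentral p G) :=
  antitone_nat_of_succ_le pCentral_succ_le

/-- The quotient map modulo a term of the descending `p`-central series. -/
abbrev pMk (p : ℕ) (k : ℕ) : G →* G ⧸ pCentral p G k := QuotientGroup.mk' _

theorem pMk_eq_one {k : ℕ} {x : G} : pMk p k x = 1 ↔ x ∈ pCentral p G k :=
  QuotientGroup.eq_one_iff x

theorem pMk_commute {k : ℕ} {x : G} (hx : x ∈ pCentral p G k) (g : G) :
    Commute (pMk p (k + 1) x) (pMk p (k + 1) g) := by
  rw [← commutatorElement_eq_one_iff_commute, ← map_commutatorElement, pMk_eq_one]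
  exact commutator_mem_pCentral hx g

theorem isClosed_comap_center (k : ℕ) : IsClosed
    (((Subgroup.center (G ⧸ pCentral p G k)).comap (pMk p k) : Subgroup G) : Set G) := by
  have : IsClosed (⋂ g : G, (fun x => x * g * x⁻¹ * g⁻¹) ⁻¹' (pCentral p G k : Set G)) :=
    isClosed_iInter fun g => (isClosed_pCentral k).preimage (by fun_prop)
  convert this using 1
  ext x
  simp only [Subgroup.coe_comap, Set.mem_preimage, SetLike.mem_coe, Subgroup.mem_center_iff,
    Set.mem_iInter]
  constructor
  · intro h g
    rw [← commutatorElement_def, ← pMk_eq_one, map_commutatorElement,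
      commutatorElement_eq_one_iff_commute]
    exact (h _).symm
  · intro h y
    obtain ⟨g, rfl⟩ := QuotientGroup.mk'_surjective _ y
    have := h g
    rw [← commutatorElement_def, ← pMk_eq_one, map_commutatorElement,
      commutatorElement_eq_one_iff_commute] at this
    exact this.symm

/-- The gain of one step over `commutator_mem_pCentral` is where the exponent 4 in the definition of
powerful enters: [G, G] ≤ G⁴, and fourth powers lie in `pCentral 2 G 2`. It is needed because the
binomial coefficient 2 choose 2 is odd. -/
theorem commutator_mem_pCentral_two (h2 : p = 2) (hG : IsPowerful p G) {i : ℕ} {x : G}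
    (hx : x ∈ pCentral p G i) (g : G) : ⁅x, g⁆ ∈ pCentral p G (i + 2) := by
  subst h2
  induction i generalizing x g with
  | zero =>
    have h3 : ⁅x, g⁆ ∈ powSubgroup G (if 2 = 2 then 4 else 2) :=
      hG (Subgroup.le_topologicalClosure _
        (Subgroup.commutator_mem_commutator (Subgroup.mem_top x) (Subgroup.mem_top g)))
    refine Subgroup.topologicalClosure_minimal _ ?_ (isClosed_pCentral 2) h3
    rw [Subgroup.closure_le]
    rintro _ ⟨y, rfl⟩
    have h4 : y ∈ pCentral 2 G 0 := Subgroup.mem_top y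
    have h5 := pow_mem_pCentral (pow_mem_pCentral h4)
    rw [← pow_mul] at h5
    simpa using h5
  | succ i ih =>
    -- Centrality modulo the term `i + 3` is a closed condition, so squares and commutators from the
    -- term `i` suffice. Commutators are covered by induction; squares because [y, g] is then
    -- central of order dividing 2.
    have hle : pCentral 2 G (i + 1) ≤
        (Subgroup.center (G ⧸ pCentral 2 G (i + 3))).comap (pMk 2 (i + 3)) := by
      refine pCentral_succ_le_of (isClosed_comap_center _) ?_ ?_
      · intro y hy
        rw [Subgroup.mem_comap, Subgroup.mem_center_iff]
        intro z
        obtain ⟨g, rfl⟩ := QuotientGroup.mk'_surjective _ z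
        have hc := ih g hy
        have h3 := pMk_commute hc y
        have h4 : (pMk 2 (i + 3) ⁅y, g⁆) ^ 2 = 1 := by
          rw [← map_pow, pMk_eq_one]
          exact pow_mem_pCentral hc
        rw [map_commutatorElement] at h3 h4
        rw [map_pow]
        exact (commute_sq_of_commute h3 h4).eq.symm
      · intro y hy g
        rw [Subgroup.mem_comap, Subgroup.mem_center_iff]
        intro z
        obtain ⟨g', rfl⟩ := QuotientGroup.mk'_surjective _ z
        exact (pMk_commute (ih g hy) g').eq.symm
    have h3 := hle hx
    rw [Subgroup.mem_comap, Subgroup.mem_center_iff] at h3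
    rw [← pMk_eq_one, map_commutatorElement, commutatorElement_eq_one_iff_commute]
    exact (h3 _).symm

/-- The commutator of x and y is central modulo the term `i + 2` and enters with exponent p choose
2. For odd p that exponent is a multiple of p; for p = 2 the commutator already lies in the term `i
+ 2`. Here `x` is arbitrary, which later allows approximation inside a coset. -/
theorem mul_pow_mod [Fact p.Prime] (hG : IsPowerful p G) {i : ℕ} (x : G) {y : G}
    (hy : y ∈ pCentral p G i) :
    pMk p (i + 2) (x * y) ^ p = pMk p (i + 2) x ^ p * pMk p (i + 2) y ^ p := by
  have hp : p.Prime := Fact.out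
  have hc : ⁅y⁻¹, x⁻¹⁆ ∈ pCentral p G (i + 1) := commutator_mem_pCentral (inv_mem hy) _
  rw [map_mul, mul_pow_of_commute (c := pMk p (i + 2) ⁅y⁻¹, x⁻¹⁆) _ (pMk_commute hc x)
    (pMk_commute hc y)]
  · have : pMk p (i + 2) ⁅y⁻¹, x⁻¹⁆ ^ p.choose 2 = 1 := by
      rw [← map_pow, pMk_eq_one]
      by_cases h2 : p = 2
      · exact pow_mem (commutator_mem_pCentral_two h2 hG (inv_mem hy) _) _
      · obtain ⟨m, hm⟩ := hp.dvd_choose_self (k := 2) (by norm_num)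
          (lt_of_le_of_ne hp.two_le (Ne.symm h2))
        rw [hm, pow_mul]
        exact pow_mem (pow_mem_pCentral hc) _
    rw [this, mul_one]
  · rw [map_commutatorElement, map_inv, map_inv, commutatorElement_def]
    group

/-- The products of a `p`-th power of an element of `P_i` with an element of `P_{i+2}`. -/
def powerLayer [Fact p.Prime] (hG : IsPowerful p G) (i : ℕ) : Subgroup G where
  carrier := {y | ∃ x ∈ pCentral p G i, pMk p (i + 2) y = pMk p (i + 2) x ^ p}
  one_mem' := ⟨1, one_mem _, by simp⟩
  mul_mem' := by
    rintro a b ⟨x, hx, hax⟩ ⟨y, hy, hby⟩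
    exact ⟨x * y, mul_mem hx hy, by rw [mul_pow_mod hG x hy, map_mul, hax, hby]⟩
  inv_mem' := by
    rintro a ⟨x, hx, hax⟩
    exact ⟨x⁻¹, inv_mem hx, by rw [map_inv, hax, map_inv, inv_pow]⟩

theorem isClosed_powerLayer [Fact p.Prime] [CompactSpace G] [T2Space G] (hG : IsPowerful p G)
    (i : ℕ) : IsClosed (powerLayer hG i : Set G) := by
  have h : (powerLayer hG i : Set G) =
      (fun z : G × G => z.1 ^ p * z.2) '' ((pCentral p G i : Set G) ×ˢ pCentral p G (i + 2)) := by
    ext y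
    constructor
    · rintro ⟨x, hx, hxy⟩
      refine ⟨(x, (x ^ p)⁻¹ * y), ⟨hx, ?_⟩, by simp⟩
      rw [SetLike.mem_coe, ← pMk_eq_one, map_mul, hxy]
      simp
    · rintro ⟨⟨x, z⟩, ⟨hx, hz⟩, rfl⟩
      refine ⟨x, hx, ?_⟩
      have := pMk_eq_one.2 hz
      dsimp only at this ⊢
      rw [map_mul, this, mul_one, map_pow]
  rw [h]
  exact (((isClosed_pCentral i).isCompact.prod (isClosed_pCentral (i + 2)).isCompact).image
    (by fun_prop)).isClosed

/-- Modulo the next layer, y is a p-th power xᵖ, and [xᵖ, g] compares xᵖ with the p-th power of the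
conjugate x v, v = [x⁻¹, g]. Since (x v)ᵖ ≡ xᵖ vᵖ, the commutator is a p-th power again. -/
theorem commutator_mem_powerLayer [Fact p.Prime] [CompactSpace G] [T2Space G]
    (hG : IsPowerful p G) {i : ℕ} {y : G} (hy : y ∈ pCentral p G i) (g : G) :
    ⁅y, g⁆ ∈ powerLayer hG i := by
  induction i generalizing y g with
  | zero =>
    have h3 : ⁅y, g⁆ ∈ powSubgroup G (if p = 2 then 4 else p) :=
      hG (Subgroup.le_topologicalClosure _
        (Subgroup.commutator_mem_commutator (Subgroup.mem_top y) (Subgroup.mem_top g)))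
    refine Subgroup.topologicalClosure_minimal _ ?_ (isClosed_powerLayer hG 0) h3
    rw [Subgroup.closure_le]
    rintro _ ⟨y, rfl⟩
    by_cases h2 : p = 2
    · refine ⟨y ^ 2, Subgroup.mem_top _, ?_⟩
      simp only [h2, if_true, map_pow, ← pow_mul]
    · exact ⟨y, Subgroup.mem_top _, by simp [h2]⟩
  | succ i ih =>
    have hle : pCentral p G (i + 1) ≤ powerLayer hG i :=
      pCentral_succ_le_of (isClosed_powerLayer hG i) (fun x hx => ⟨x, hx, by simp⟩)
        fun x hx g => ih hx g
    obtain ⟨x, hx, hxy⟩ := hle hy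
    have hz : (x ^ p)⁻¹ * y ∈ pCentral p G (i + 2) := by
      rw [← pMk_eq_one, map_mul, hxy]; simp
    have hv : ⁅x⁻¹, g⁆ ∈ pCentral p G (i + 1) := commutator_mem_pCentral (inv_mem hx) g
    -- The inverse of v: [y, g] ≡ xᵖ (xᵖ vᵖ)⁻¹, and vᵖ is central modulo the term `i + 3`.
    refine ⟨⁅x⁻¹, g⁆⁻¹, inv_mem hv, ?_⟩
    have h1 : pMk p (i + 3) (x * ⁅x⁻¹, g⁆) ^ p =
        pMk p (i + 3) x ^ p * pMk p (i + 3) ⁅x⁻¹, g⁆ ^ p := mul_pow_mod hG x hv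
    have h2 : x * ⁅x⁻¹, g⁆ = g * x * g⁻¹ := by rw [commutatorElement_def]; group
    rw [h2, ← map_pow, conj_pow] at h1
    have h3 : Commute (pMk p (i + 3) (⁅x⁻¹, g⁆ ^ p)) (pMk p (i + 3) x ^ p) := by
      rw [← map_pow]
      exact pMk_commute (pow_mem_pCentral hv) _
    have h4 := pMk_commute hz g
    have h5 : ⁅y, g⁆ = x ^ p * ((x ^ p)⁻¹ * y * g * ((x ^ p)⁻¹ * y)⁻¹ * g⁻¹) *
      (g * (x ^ p) * g⁻¹)⁻¹ := by
      rw [commutatorElement_def]; group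
    have h6 : pMk p (i + 3) ((x ^ p)⁻¹ * y * g * ((x ^ p)⁻¹ * y)⁻¹ * g⁻¹) = 1 := by
      rw [← commutatorElement_def, map_commutatorElement, commutatorElement_eq_one_iff_commute]
      exact h4
    change pMk p (i + 3) ⁅y, g⁆ = pMk p (i + 3) _ ^ p
    rw [h5, map_mul, map_mul, h6, mul_one, map_inv, h1, map_inv, inv_pow, mul_inv_rev, map_pow]
    rw [map_pow] at h3
    rw [← mul_assoc, ← h3.inv_left.eq, mul_assoc, mul_inv_cancel, mul_one]

/-- Surjectivity of the p-th power map between consecutive layers: the closed subgroup `powerLayer`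
contains all generators of the term `i + 1`. -/
theorem exists_pow_of_mem_pCentral [Fact p.Prime] [CompactSpace G] [T2Space G]
    (hG : IsPowerful p G) {i : ℕ} {y : G} (hy : y ∈ pCentral p G (i + 1)) :
    ∃ x ∈ pCentral p G i, pMk p (i + 2) y = pMk p (i + 2) x ^ p :=
  pCentral_succ_le_of (H := powerLayer hG i) (isClosed_powerLayer hG i)
    (fun x hx => ⟨x, hx, by simp⟩) (fun _ hx g => commutator_mem_powerLayer hG hx g) hy

/-- Induction on the order: divide `Q` by a central subgroup of order p. Once a term of the series
maps into it, the next term maps to 1. -/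
theorem exists_pCentral_le_ker [Fact p.Prime] (k : ℕ) : ∀ (Q : Type u) [Group Q]
    (_ : Nat.card Q = p ^ k) (f : G →* Q) (_ : IsOpen (f.ker : Set G)),
    ∃ n, pCentral p G n ≤ f.ker := by
  have hp : p.Prime := Fact.out
  induction k with
  | zero =>
    intro Q _ hQ f _
    have : Subsingleton Q := (Nat.card_eq_one_iff_unique.1 (by simpa using hQ)).1
    exact ⟨0, fun x _ => Subsingleton.elim _ _⟩
  | succ k ih =>
    intro Q _ hQ f hf
    have : Finite Q := Nat.finite_of_card_ne_zero (by rw [hQ]; exact pow_ne_zero _ hp.ne_zero)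
    have hpQ : IsPGroup p Q := IsPGroup.of_card hQ
    have : Nontrivial Q := by
      rw [← Finite.one_lt_card_iff_nontrivial, hQ]
      exact Nat.one_lt_pow (by omega) hp.one_lt
    have hZ := hpQ.center_nontrivial
    have hZp : IsPGroup p (Subgroup.center Q) := hpQ.to_subgroup _
    obtain ⟨m, hm⟩ := hZp.exists_card_eq
    have hm0 : m ≠ 0 := by
      rintro rfl
      have := Finite.one_lt_card (α := Subgroup.center Q)
      rw [hm, pow_zero] at this
      exact lt_irrefl _ this
    obtain ⟨z, hz⟩ := exists_prime_orderOf_dvd_card' (G := Subgroup.center Q) p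
      (by rw [hm]; exact dvd_pow_self p hm0)
    have hz' : orderOf (z : Q) = p := by rw [Subgroup.orderOf_coe, hz]
    let Z := Subgroup.zpowers (z : Q)
    have hZc : ∀ w ∈ Z, ∀ g : Q, Commute w g := by
      rintro w ⟨n, rfl⟩ g
      have h1 : Commute (z : Q) g := (Subgroup.mem_center_iff.1 z.2 g).symm
      exact h1.zpow_left n
    have hZn : Z.Normal := ⟨fun w hw g => by rw [← (hZc w hw g).eq]; simpa using hw⟩
    have hcard : Nat.card (Q ⧸ Z) = p ^ k := by
      have h1 := Z.card_eq_card_quotient_mul_card_subgroup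
      rw [hQ, Nat.card_zpowers, hz', pow_succ] at h1
      exact (Nat.eq_of_mul_eq_mul_right hp.pos h1).symm
    obtain ⟨n, hn⟩ := ih (Q ⧸ Z) hcard ((QuotientGroup.mk' Z).comp f)
      (Subgroup.isOpen_mono (fun x hx => by
        rw [MonoidHom.mem_ker, MonoidHom.comp_apply, MonoidHom.mem_ker.1 hx, map_one]) hf)
    have hn' : ∀ x ∈ pCentral p G n, f x ∈ Z := fun x hx =>
      (QuotientGroup.eq_one_iff _).1 (hn hx)
    refine ⟨n + 1, pCentral_succ_le_of (Subgroup.isClosed_of_isOpen _ hf) ?_ ?_⟩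
    · intro x hx
      obtain ⟨j, hj⟩ := hn' x hx
      have hj' : (z : Q) ^ j = f x := hj
      have h3 : (z : Q) ^ p = 1 := by rw [← hz']; exact pow_orderOf_eq_one _
      rw [MonoidHom.mem_ker, map_pow, ← hj', ← zpow_natCast, zpow_comm, zpow_natCast, h3, one_zpow]
    · intro x hx g
      rw [MonoidHom.mem_ker, map_commutatorElement, commutatorElement_eq_one_iff_commute]
      exact hZc _ (hn' x hx) _

theorem eq_one_of_forall_mem_pCentral [Fact p.Prime] [T2Space G] (hP : IsProP p G) {x : G}
    (hx : ∀ n, x ∈ pCentral p G n) : x = 1 := by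
  by_contra hne
  obtain ⟨K, hK, hKo, ⟨k, hk⟩, hKx⟩ := hP {x}ᶜ (isOpen_compl_singleton.mem_nhds (Ne.symm hne))
  have hker : (QuotientGroup.mk' K).ker = K := QuotientGroup.ker_mk' K
  obtain ⟨n, hn⟩ := exists_pCentral_le_ker (p := p) k (G ⧸ K) hk (QuotientGroup.mk' K)
    (by rw [hker]; exact hKo)
  rw [hker] at hn
  exact hKx (hn (hx n)) rfl

/-- Successive approximation: `x` is corrected inside its coset modulo the term `i + 1` so that its
p-th power sinks ever deeper. Compactness gives a limit, whose p-th power lies in all terms and so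
is 1. -/
theorem exists_torsion [Fact p.Prime] [CompactSpace G] [T2Space G] (hP : IsProP p G)
    (hG : IsPowerful p G) {i : ℕ} {x : G} (hx : x ∉ pCentral p G (i + 1))
    (hxp : x ^ p ∈ pCentral p G (i + 2)) : ∃ y : G, y ≠ 1 ∧ y ^ p = 1 := by
  let K : ℕ → Set G := fun n =>
    {y | x⁻¹ * y ∈ pCentral p G (i + 1) ∧ y ^ p ∈ pCentral p G (i + 2 + n)}
  have hKc : ∀ n, IsClosed (K n) := fun n =>
    ((isClosed_pCentral (i + 1)).preimage (by fun_prop : Continuous fun y : G => x⁻¹ * y)).inter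
      ((isClosed_pCentral (i + 2 + n)).preimage (by fun_prop : Continuous fun y : G => y ^ p))
  have hKn : ∀ n, (K n).Nonempty := by
    intro n
    induction n with
    | zero => exact ⟨x, by simp, hxp⟩
    | succ n ih =>
      obtain ⟨w, hw1, hw2⟩ := ih
      obtain ⟨y, hy, hwy⟩ := exists_pow_of_mem_pCentral hG (i := i + 1 + n) (y := w ^ p)
        (by convert hw2 using 2; omega)
      -- As yᵖ agrees with wᵖ modulo the next term, dividing by y removes the leading error.
      refine ⟨w * y⁻¹, ?_, ?_⟩
      · rw [← mul_assoc]
        exact mul_mem hw1 (inv_mem (pCentral_antitone (by omega) hy))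
      · have h1 := mul_pow_mod hG w (inv_mem hy)
        rw [← map_pow, ← map_pow, hwy, map_inv, inv_pow, mul_inv_cancel, pMk_eq_one] at h1
        convert h1 using 2
        omega
  have hKa : ∀ n, K (n + 1) ⊆ K n := fun n y hy => ⟨hy.1, pCentral_antitone (by omega) hy.2⟩
  obtain ⟨y, hy⟩ := IsCompact.nonempty_iInter_of_sequence_nonempty_isCompact_isClosed K hKa hKn
    (hKc 0).isCompact hKc
  rw [Set.mem_iInter] at hy
  refine ⟨y, ?_, ?_⟩
  · rintro rfl
    have := (hy 0).1
    rw [mul_one] at this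
    exact hx (inv_mem_iff.1 this)
  · refine eq_one_of_forall_mem_pCentral hP fun n => ?_
    exact pCentral_antitone (by omega) (hy n).2

/-- The p-th power map between consecutive layers is onto by `exists_pow_of_mem_pCentral`; a
nontrivial kernel would produce torsion by `exists_torsion`. -/
theorem relIndex_pCentral_succ [Fact p.Prime] [CompactSpace G] [T2Space G] (hP : IsProP p G)
    (hG : IsPowerful p G) (ht : ∀ y : G, y ^ p = 1 → y = 1) (i : ℕ) :
    (pCentral p G (i + 2)).relIndex (pCentral p G (i + 1)) =
      (pCentral p G (i + 1)).relIndex (pCentral p G i) := by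
  let ψ : pCentral p G i →* G ⧸ pCentral p G (i + 2) :=
    { toFun := fun x => pMk p (i + 2) (x : G) ^ p
      map_one' := by simp
      map_mul' := fun x y => mul_pow_mod hG x.1 y.2 }
  have hker : ψ.ker = (pCentral p G (i + 1)).subgroupOf (pCentral p G i) := by
    ext x
    rw [Subgroup.mem_subgroupOf, MonoidHom.mem_ker]
    change pMk p (i + 2) (x : G) ^ p = 1 ↔ _
    rw [← map_pow, pMk_eq_one]
    constructor
    · intro h
      by_contra hx
      obtain ⟨y, hy, hyp⟩ := exists_torsion hP hG hx h
      exact hy (ht y hyp)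
    · exact fun h => pow_mem_pCentral h
  have hrange : ψ.range = (pCentral p G (i + 1)).map (pMk p (i + 2)) := by
    ext z
    constructor
    · rintro ⟨x, rfl⟩
      exact ⟨x.1 ^ p, pow_mem_pCentral x.2, map_pow _ _ _⟩
    · rintro ⟨y, hy, rfl⟩
      obtain ⟨x, hx, hxy⟩ := exists_pow_of_mem_pCentral hG hy
      exact ⟨⟨x, hx⟩, hxy.symm⟩
  have h1 : (pCentral p G (i + 1)).relIndex (pCentral p G i) = ψ.ker.index := by
    rw [hker]; rfl
  rw [h1, Subgroup.index_ker, hrange]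
  have h2 := Subgroup.relIndex_ker (pCentral p G (i + 1)) (pMk p (i + 2))
  rw [QuotientGroup.ker_mk'] at h2
  rw [h2]

theorem isUniform_of_torsionFree [Fact p.Prime] [CompactSpace G] [T2Space G] (hP : IsProP p G)
    (hfg : ∃ S : Finset G, (Subgroup.closure (S : Set G)).topologicalClosure = ⊤)
    (hG : IsPowerful p G) (ht : ∀ y : G, y ^ p = 1 → y = 1) : IsUniform p G := by
  refine ⟨hfg, hG, fun i => ?_⟩
  induction i with
  | zero => exact Subgroup.relIndex_top_right _
  | succ i ih => rw [← ih]; exact relIndex_pCentral_succ hP hG ht i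

end Central

/-! ### Homogeneous cochains -/

section Homogeneous

variable {X A B : Type*} [AddCommGroup A] [AddCommGroup B]

/-- The differential of homogeneous cochains. -/
def homD {n : ℕ} (f : (Fin n → X) → A) (x : Fin (n + 1) → X) : A :=
  ∑ j : Fin (n + 1), (-1 : ℤ) ^ (j : ℕ) • f fun i => x (j.succAbove i)

theorem homD_sub {n : ℕ} (f g : (Fin n → X) → A) (x : Fin (n + 1) → X) :
    homD (fun y => f y - g y) x = homD f x - homD g x := by
  simp [homD, smul_sub, Finset.sum_sub_distrib]

theorem homD_add {n : ℕ} (f g : (Fin n → X) → A) (x : Fin (n + 1) → X) :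
    homD (fun y => f y + g y) x = homD f x + homD g x := by
  simp [homD, smul_add, Finset.sum_add_distrib]

theorem homD_sum {ι : Type*} (s : Finset ι) {n : ℕ} (f : ι → (Fin n → X) → A)
    (x : Fin (n + 1) → X) : homD (fun y => ∑ z ∈ s, f z y) x = ∑ z ∈ s, homD (f z) x := by
  simp only [homD, Finset.smul_sum]
  exact Finset.sum_comm

theorem homD_map (φ : A →+ B) {n : ℕ} (f : (Fin n → X) → A) (x : Fin (n + 1) → X) :
    homD (fun y => φ (f y)) x = φ (homD f x) := by
  simp [homD, map_sum, map_zsmul]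

theorem homD_comp {Y : Type*} (h : Y → X) {n : ℕ} (f : (Fin n → X) → A) (x : Fin (n + 1) → Y) :
    homD (fun y : Fin n → Y => f fun i => h (y i)) x = homD f fun i => h (x i) := rfl

/-- Splitting off the first variable; this recursion replaces sign bookkeeping in what follows. -/
theorem homD_cons {n : ℕ} (f : (Fin (n + 1) → X) → A) (a : X) (x : Fin (n + 1) → X) :
    homD f (Fin.cons a x : Fin (n + 2) → X) =
      f x - homD (fun y : Fin n → X => f (Fin.cons a y : Fin (n + 1) → X)) x := by
  rw [homD, Fin.sum_univ_succ, homD, sub_eq_add_neg, ← Finset.sum_neg_distrib]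
  congr 1
  · simp
  · refine Finset.sum_congr rfl fun j _ => ?_
    have : (fun i => (Fin.cons a x : Fin (n + 2) → X) (j.succ.succAbove i)) =
        (Fin.cons a (fun i => x (j.succAbove i)) : Fin (n + 1) → X) := by
      funext i
      refine Fin.cases ?_ (fun i => ?_) i
      · simp
      · simp
    rw [this, Fin.val_succ, pow_succ]
    simp

theorem homD_homD {n : ℕ} (f : (Fin n → X) → A) (x : Fin (n + 2) → X) : homD (homD f) x = 0 := by
  induction n with
  | zero =>
    have h : ∀ y z : Fin 0 → X, f y = f z := fun y z => by rw [Subsingleton.elim y z]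
    rw [homD, Fin.sum_univ_two]
    simp [homD, h _ (fun i => i.elim0)]
  | succ n ih =>
    rw [← Fin.cons_self_tail x, homD_cons]
    have : (fun y : Fin (n + 1) → X => homD f (Fin.cons (x 0) y : Fin (n + 2) → X)) = fun y =>
        f y - homD (fun z : Fin n → X => f (Fin.cons (x 0) z : Fin (n + 1) → X)) y := by
      funext y
      exact homD_cons f _ _
    rw [this, homD_sub, ih]
    simp

end Homogeneous

/-! ### Nonvanishing cohomology of the group of order `p` -/

section Cyclic

variable {p : ℕ} [Fact p.Prime]

/-- Every homogeneous cocycle on `C` with values in `𝔽_p` of degree `m + 1` is a coboundary. -/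
def CocyclesSplit (p : ℕ) (C : Type*) [Group C] (m : ℕ) : Prop :=
  ∀ f : (Fin (m + 2) → C) → ZMod p, (∀ (g : C) x, f (fun i => g * x i) = f x) →
    (∀ x, homD f x = 0) → ∃ b : (Fin (m + 1) → C) → ZMod p,
      (∀ (g : C) x, b (fun i => g * x i) = b x) ∧ ∀ x, homD b x = f x

/-- The cyclic group of order `p`, written multiplicatively. -/
abbrev Cyc (p : ℕ) : Type := Multiplicative (ZMod p)

/-- A generator of the cyclic group of order `p`. -/
def cycGen (p : ℕ) : Cyc p := Multiplicative.ofAdd 1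

theorem sum_cycGen_mul {A : Type*} [AddCommMonoid A] (F : Cyc p → A) :
    ∑ z, F (cycGen p * z) = ∑ z, F z :=
  Equiv.sum_comp (Equiv.mulLeft (cycGen p)) F

/-- The chain map of degree `-2` given by `(T f)(y) = ∑ z, f (z, c z, y)`. -/
def cycShift {n : ℕ} (f : (Fin (n + 2) → Cyc p) → ZMod p) (y : Fin n → Cyc p) : ZMod p :=
  ∑ z : Cyc p, f (Fin.cons z (Fin.cons (cycGen p * z) y : Fin (n + 1) → Cyc p))

/-- The two extra terms f(cz, y) − f(z, y) cancel when summed over the whole cycle. -/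
theorem cycShift_homD {n : ℕ} (f : (Fin (n + 2) → Cyc p) → ZMod p) (y : Fin (n + 1) → Cyc p) :
    cycShift (homD f) y = homD (cycShift f) y := by
  unfold cycShift
  rw [homD_sum]
  have h : ∀ z : Cyc p, homD f (Fin.cons z (Fin.cons (cycGen p * z) y : Fin (n + 2) → Cyc p)) =
      f (Fin.cons (cycGen p * z) y) - f (Fin.cons z y) +
      homD (fun w : Fin n → Cyc p =>
        f (Fin.cons z (Fin.cons (cycGen p * z) w : Fin (n + 1) → Cyc p))) y := by
    intro z
    rw [homD_cons, homD_cons]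
    abel
  rw [Finset.sum_congr rfl fun z _ => h z, Finset.sum_add_distrib, Finset.sum_sub_distrib]
  rw [sum_cycGen_mul (fun z => f (Fin.cons z y : Fin (n + 2) → Cyc p))]
  simp

theorem cons_smul {C : Type*} [Group C] {n : ℕ} (g z : C) (y : Fin n → C) :
    (fun i => g * (Fin.cons z y : Fin (n + 1) → C) i) =
      (Fin.cons (g * z) (fun i => g * y i) : Fin (n + 1) → C) := by
  funext i
  refine Fin.cases ?_ (fun i => ?_) i <;> simp

theorem cycShift_smul {n : ℕ} (f : (Fin (n + 2) → Cyc p) → ZMod p)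
    (hf : ∀ (g : Cyc p) x, f (fun i => g * x i) = f x) (g : Cyc p) (y : Fin n → Cyc p) :
    cycShift f (fun i => g * y i) = cycShift f y := by
  unfold cycShift
  rw [← Equiv.sum_comp (Equiv.mulLeft g)]
  refine Finset.sum_congr rfl fun z _ => ?_
  rw [← hf g (Fin.cons z (Fin.cons (cycGen p * z) y : Fin (n + 1) → Cyc p)), cons_smul, cons_smul,
    mul_left_comm]
  rfl

/-- The integral lift of `z⁻¹ w`. -/
def cycDiff (z w : Cyc p) : ℤ := ((Multiplicative.toAdd (z⁻¹ * w)).val : ℤ)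

theorem cycDiff_smul (g z w : Cyc p) : cycDiff (g * z) (g * w) = cycDiff z w := by
  unfold cycDiff
  congr 3
  group

theorem dvd_cycDiff (x y z : Cyc p) : (p : ℤ) ∣ cycDiff y z - cycDiff x z + cycDiff x y := by
  rw [← ZMod.intCast_zmod_eq_zero_iff_dvd]
  simp [cycDiff]

/-- The Bockstein cocycle of a cyclic group of order `p`. -/
def cycBock (x y z : Cyc p) : ZMod p :=
  (((cycDiff y z - cycDiff x z + cycDiff x y) / p : ℤ) : ZMod p)

theorem cycBock_smul (g x y z : Cyc p) : cycBock (g * x) (g * y) (g * z) = cycBock x y z := by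
  simp only [cycBock, cycDiff_smul]

/-- `cycBock` is an integral coboundary divided by p, so its coboundary vanishes already over ℤ. -/
theorem cycBock_cocycle (x y z w : Cyc p) :
    cycBock y z w - cycBock x z w + cycBock x y w - cycBock x y z = 0 := by
  obtain ⟨a, ha⟩ := dvd_cycDiff y z w
  obtain ⟨b, hb⟩ := dvd_cycDiff x z w
  obtain ⟨c, hc⟩ := dvd_cycDiff x y w
  obtain ⟨d, hd⟩ := dvd_cycDiff x y z
  have hp : (p : ℤ) ≠ 0 := by exact_mod_cast (Fact.out : p.Prime).ne_zero
  unfold cycBock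
  rw [ha, hb, hc, hd]
  simp only [Int.mul_ediv_cancel_left _ hp]
  have h : (p : ℤ) * (a - b + c - d) = 0 := by linear_combination -ha + hb - hc + hd
  have h2 : a - b + c - d = 0 := (mul_eq_zero.1 h).resolve_left hp
  exact_mod_cast congrArg (Int.cast : ℤ → ZMod p) h2

/-- Each step z to cz has integral difference 1 and the other terms cancel, so the numerators add up
to p. -/
theorem sum_cycBock (y : Cyc p) : ∑ z : Cyc p, cycBock z (cycGen p * z) y = 1 := by
  have hp : (p : ℤ) ≠ 0 := by exact_mod_cast (Fact.out : p.Prime).ne_zero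
  have : Fact (1 < p) := ⟨(Fact.out : p.Prime).one_lt⟩
  choose a ha using fun z : Cyc p => dvd_cycDiff z (cycGen p * z) y
  have h1 : ∀ z : Cyc p, cycDiff z (cycGen p * z) = 1 := by
    intro z
    have : z⁻¹ * (cycGen p * z) = cycGen p := by rw [mul_comm (cycGen p) z, inv_mul_cancel_left]
    rw [cycDiff, this]
    simp [cycGen, ZMod.val_one]
  have h2 : (p : ℤ) * ∑ z, a z = p * 1 := by
    rw [Finset.mul_sum, ← Finset.sum_congr rfl fun z _ => ha z]
    rw [Finset.sum_add_distrib, Finset.sum_sub_distrib,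
      sum_cycGen_mul (fun z => cycDiff z y), Finset.sum_congr rfl fun z _ => h1 z]
    simp [ZMod.card]
  have h3 := mul_left_cancel₀ hp h2
  unfold cycBock
  rw [Finset.sum_congr rfl fun z _ => by rw [ha z, Int.mul_ediv_cancel_left _ hp]]
  exact_mod_cast congrArg (Int.cast : ℤ → ZMod p) h3

/-- Periodicity: multiply by the Bockstein cocycle to raise the degree by 2, split there, and return
with `cycShift`, which undoes the multiplication by `sum_cycBock`. -/
theorem CocyclesSplit.descend {m : ℕ} (h : CocyclesSplit p (Cyc p) (m + 2)) :
    CocyclesSplit p (Cyc p) m := by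
  intro f hf hdf
  let F : (Fin (m + 4) → Cyc p) → ZMod p := fun x =>
    cycBock (x 0) (x 1) (x 2) * f fun i => x i.succ.succ
  have hF3 : ∀ (a b : Cyc p) (x : Fin (m + 2) → Cyc p),
      F (Fin.cons a (Fin.cons b x : Fin (m + 3) → Cyc p)) = cycBock a b (x 0) * f x :=
    fun a b x => rfl
  have hF1 : ∀ (g : Cyc p) x, F (fun i => g * x i) = F x := by
    intro g x
    change cycBock _ _ _ * f (fun i => g * x i.succ.succ) = _
    rw [cycBock_smul, hf g fun i => x i.succ.succ]
  have hF2 : ∀ x, homD F x = 0 := by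
    intro x
    obtain ⟨a, x, rfl⟩ : ∃ a y, x = Fin.cons a y := ⟨_, _, (Fin.cons_self_tail x).symm⟩
    obtain ⟨b, x, rfl⟩ : ∃ a y, x = Fin.cons a y := ⟨_, _, (Fin.cons_self_tail x).symm⟩
    obtain ⟨c, x, rfl⟩ : ∃ a y, x = Fin.cons a y := ⟨_, _, (Fin.cons_self_tail x).symm⟩
    rw [homD_cons, homD_cons, homD_cons, hF3, hF3, hF3]
    have e : (fun y : Fin (m + 1) → Cyc p => F (Fin.cons a (Fin.cons b
        (Fin.cons c y : Fin (m + 2) → Cyc p) : Fin (m + 3) → Cyc p))) = fun y =>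
        AddMonoidHom.mulLeft (cycBock a b c) (f (Fin.cons c y : Fin (m + 2) → Cyc p)) := by
      funext y
      rw [hF3]
      rfl
    rw [e, homD_map]
    have h1 := hdf (Fin.cons c x)
    rw [homD_cons, sub_eq_zero] at h1
    rw [← h1]
    have h2 := cycBock_cocycle a b c (x 0)
    simp only [AddMonoidHom.coe_mulLeft]
    linear_combination f x * h2
  obtain ⟨b, hb, hbF⟩ := h F hF1 hF2
  refine ⟨cycShift b, cycShift_smul b hb, fun x => ?_⟩
  rw [← cycShift_homD]
  have : homD b = F := funext hbF
  rw [this, cycShift]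
  rw [Finset.sum_congr rfl fun z _ => hF3 z (cycGen p * z) x, ← Finset.sum_mul, sum_cycBock,
    one_mul]

/-- `cycShift` takes the Bockstein cocycle to 1, but takes an invariant cochain of degree 1 to a sum
of p equal terms, which is 0. -/
theorem not_cocyclesSplit_one : ¬ CocyclesSplit p (Cyc p) 1 := by
  intro h
  obtain ⟨b, hb, hbB⟩ := h (fun x => cycBock (x 0) (x 1) (x 2)) (fun g x => cycBock_smul _ _ _ _)
    (by
      intro x
      have := cycBock_cocycle (x 0) (x 1) (x 2) (x 3)
      rw [← this, homD, Fin.sum_univ_four]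
      simp only [Fin.val_zero, pow_zero, one_smul, Fin.val_one, pow_one, neg_smul, Fin.val_two,
        even_two, Even.neg_pow, one_pow]
      rw [show ((3 : Fin 4) : ℕ) = 3 from rfl, show (-1 : ℤ) ^ 3 = -1 from rfl, neg_smul, one_smul]
      rw [sub_eq_add_neg, sub_eq_add_neg]
      rfl)
  have h1 := cycShift_homD b (fun _ => 1)
  have h2 : homD b = fun x => cycBock (x 0) (x 1) (x 2) := funext hbB
  have h3 : ∀ y, cycShift b y = 0 := by
    intro y
    rw [cycShift]
    have : ∀ z : Cyc p, b (Fin.cons z (Fin.cons (cycGen p * z) y : Fin 1 → Cyc p)) =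
        b (Fin.cons 1 (Fin.cons (cycGen p) y : Fin 1 → Cyc p)) := by
      intro z
      rw [← hb z (Fin.cons 1 (Fin.cons (cycGen p) y : Fin 1 → Cyc p)), cons_smul, cons_smul, mul_one,
        mul_comm]
      congr 3
      exact Subsingleton.elim _ _
    rw [Finset.sum_congr rfl fun z _ => this z]
    simp [ZMod.card]
  have h4 : homD (cycShift b) (fun _ => 1) = 0 := by
    simp [homD, h3]
  rw [h4, h2] at h1
  have h5 : cycShift (fun x : Fin 3 → Cyc p => cycBock (x 0) (x 1) (x 2)) (fun _ => 1) = 1 :=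
    sum_cycBock 1
  rw [h5] at h1
  exact one_ne_zero h1

/-- The index is one less than the degree, so these are the even degrees 2, 4, 6, …. -/
theorem not_cocyclesSplit_odd (m : ℕ) : ¬ CocyclesSplit p (Cyc p) (2 * m + 1) := by
  induction m with
  | zero => exact not_cocyclesSplit_one
  | succ m ih => exact fun h => ih (CocyclesSplit.descend h)

end Cyclic

theorem isLocallyConstant_homD {X : Type*} [TopologicalSpace X] {A : Type*} [AddCommGroup A]
    {n : ℕ} {f : (Fin n → X) → A} (hf : IsLocallyConstant f) : IsLocallyConstant (homD f) := by
  classical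
  unfold homD
  induction (Finset.univ : Finset (Fin (n + 1))) using Finset.induction_on with
  | empty =>
    simp only [Finset.sum_empty]
    exact IsLocallyConstant.const 0
  | insert j s hj ih =>
    simp only [Finset.sum_insert hj]
    have h1 : IsLocallyConstant fun x : Fin (n + 1) → X =>
        (-1 : ℤ) ^ (j : ℕ) • f fun i => x (j.succAbove i) :=
      (hf.comp_continuous (by fun_prop :
        Continuous fun (x : Fin (n + 1) → X) (i : Fin n) => x (j.succAbove i))).comp
          fun a => (-1 : ℤ) ^ (j : ℕ) • a
    exact h1.add ih

/-! ### Passing vanishing to finite modules and to subgroups of order `p` -/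

section Split

variable {p : ℕ} {G : Type u} [Group G] [TopologicalSpace G]

variable (p G) in
/-- Every continuous homogeneous cocycle of degree `m + 1` with values in `𝔽_p` is a coboundary. -/
def TrivSplit (m : ℕ) : Prop :=
  ∀ f : (Fin (m + 2) → G) → ZMod p, IsLocallyConstant f →
    (∀ (g : G) x, f (fun i => g * x i) = f x) → (∀ x, homD f x = 0) →
    ∃ b : (Fin (m + 1) → G) → ZMod p, IsLocallyConstant b ∧
      (∀ (g : G) x, b (fun i => g * x i) = b x) ∧ ∀ x, homD b x = f x

/-- Every continuous homogeneous cocycle of degree `m + 1` with values in `M` is a coboundary. -/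
def RepSplit {Q : Type*} [Group Q] (π : G →* Q) {M : Type*} [AddCommGroup M] [Module (ZMod p) M]
    (ρ : Representation (ZMod p) Q M) (m : ℕ) : Prop :=
  ∀ f : (Fin (m + 2) → G) → M, IsLocallyConstant f →
    (∀ (g : G) x, f (fun i => g * x i) = ρ (π g) (f x)) → (∀ x, homD f x = 0) →
    ∃ b : (Fin (m + 1) → G) → M, IsLocallyConstant b ∧
      (∀ (g : G) x, b (fun i => g * x i) = ρ (π g) (b x)) ∧ ∀ x, homD b x = f x

/-- The usual dictionary: partial products turn inhomogeneous variables into homogeneous ones, and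
the quotients xᵢ⁻¹ xᵢ₊₁ go back. -/
theorem trivSplit_of_le_coboundaries [IsTopologicalGroup G] {m : ℕ}
    (h : cocycles p G (m + 1) ≤ coboundaries p G (m + 1)) : TrivSplit p G m := by
  intro f hf hinv hd
  have hpp : ∀ n, Continuous fun (v : Fin n → G) (i : Fin (n + 1)) => Fin.partialProd v i := by
    intro n
    refine continuous_pi fun i => ?_
    induction i using Fin.inductionOn with
    | zero => simpa using continuous_const
    | succ i ih =>
      simp only [Fin.partialProd_succ]
      exact ih.mul (continuous_apply i)
  let φ : Cochain p G (m + 1) := ⟨fun v => f (Fin.partialProd v), hf.comp_continuous (hpp _)⟩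
  have hφ : ∀ v, φ v = f (Fin.partialProd v) := fun v => rfl
  have hφd : φ ∈ cocycles p G (m + 1) := by
    change d p G (m + 1) φ = 0
    ext v
    rw [d_apply, LocallyConstant.zero_apply, ← hd (Fin.partialProd v)]
    conv_rhs => rw [homD, Fin.sum_univ_succ]
    congr 1
    · rw [hφ, ← hinv (v 0) (Fin.partialProd _)]
      simp only [Fin.val_zero, pow_zero, one_smul, Fin.succAbove_zero]
      congr 1
      funext i
      rw [Fin.partialProd_succ']
      rfl
    · refine Finset.sum_congr rfl fun j _ => ?_
      rw [hφ, Fin.partialProd_contractNth, Fin.val_succ]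
      simp only [zsmul_eq_mul, Int.cast_pow, Int.cast_neg, Int.cast_one]
      rfl
  obtain ⟨b, hb⟩ := h hφd
  let D : C(Fin (m + 1) → G, Fin m → G) :=
    ⟨fun x i => (x i.castSucc)⁻¹ * x i.succ, by fun_prop⟩
  refine ⟨fun x => b (D x), b.isLocallyConstant.comp_continuous D.continuous, ?_, ?_⟩
  · intro g x
    refine congrArg b ?_
    funext i
    change (g * x i.castSucc)⁻¹ * (g * x i.succ) = (x i.castSucc)⁻¹ * x i.succ
    group
  · intro x
    set v : Fin (m + 1) → G := fun i => (x i.castSucc)⁻¹ * x i.succ with hv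
    have hx : ∀ i, x i = x 0 * Fin.partialProd v i := fun i =>
      (congrFun (Fin.partialProd_left_inv x) i).symm
    have hfx : f x = φ v := by
      rw [hφ, ← hinv (x 0) (Fin.partialProd v)]
      congr 1
      funext i
      exact hx i
    rw [hfx, ← hb, d_apply]
    conv_lhs => rw [homD, Fin.sum_univ_succ]
    congr 1
    · simp only [Fin.val_zero, pow_zero, one_smul]
      congr 1
    · refine Finset.sum_congr rfl fun j _ => ?_
      rw [Fin.val_succ]
      simp only [zsmul_eq_mul, Int.cast_pow, Int.cast_neg, Int.cast_one]
      congr 2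
      funext i
      rw [← Fin.inv_partialProd_mul_eq_contractNth]
      change (x (j.succ.succAbove i.castSucc))⁻¹ * x (j.succ.succAbove i.succ) = _
      rw [hx (j.succ.succAbove i.castSucc), hx (j.succ.succAbove i.succ), Fin.succ_succAbove_succ]
      group

theorem exists_fixed_vector [Fact p.Prime] {Q : Type*} [Group Q] (hQ : IsPGroup p Q)
    {M : Type*} [AddCommGroup M] [Module (ZMod p) M] [Finite M] [Nontrivial M]
    (ρ : Representation (ZMod p) Q M) : ∃ a : M, a ≠ 0 ∧ ∀ g, ρ g a = a := by
  let _ : MulAction Q M :=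
    { smul := fun g x => ρ g x
      one_smul := fun x => by change ρ 1 x = x; simp
      mul_smul := fun g h x => by change ρ (g * h) x = ρ g (ρ h x); simp }
  have hcard : p ∣ Nat.card M := by
    have h1 : Nat.card M = Nat.card (ZMod p) ^ Module.finrank (ZMod p) M :=
      Module.natCard_eq_pow_finrank
    rw [h1, Nat.card_zmod]
    exact dvd_pow_self p Module.finrank_pos.ne'
  obtain ⟨a, ha, hne⟩ := hQ.exists_fixed_point_of_prime_dvd_card_of_fixed_point M hcard (a := 0)
    (fun g => map_zero (ρ g))
  exact ⟨a, hne.symm, ha⟩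

/-- Dévissage: a p-group fixes a nonzero vector a. Split the cocycle modulo the line of a, lift, and
split the remaining error, a cocycle with trivial coefficients. -/
theorem TrivSplit.repSplit [Fact p.Prime] {Q : Type v} [Group Q] (hQ : IsPGroup p Q) (π : G →* Q)
    (hπ : IsLocallyConstant π) {m : ℕ} (h : TrivSplit p G m) (k : ℕ) :
    ∀ (M : Type w) [AddCommGroup M] [Module (ZMod p) M] [Finite M]
      (_ : Module.finrank (ZMod p) M = k) (ρ : Representation (ZMod p) Q M), RepSplit π ρ m := by
  induction k with
  | zero =>
    intro M _ _ _ hM ρ f _ _ _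
    have : Subsingleton M := Module.finrank_zero_iff.1 hM
    exact ⟨fun _ => 0, IsLocallyConstant.const 0, fun _ _ => Subsingleton.elim _ _,
      fun _ => Subsingleton.elim _ _⟩
  | succ k ih =>
    intro M _ _ _ hM ρ f hf hfe hfd
    have : Nontrivial M := Module.nontrivial_of_finrank_pos (R := ZMod p) (by omega)
    obtain ⟨a, ha0, ha⟩ := exists_fixed_vector hQ ρ
    let A : Submodule (ZMod p) M := Submodule.span (ZMod p) {a}
    have hA : ∀ g, A ≤ A.comap (ρ g) := by
      intro g
      rw [Submodule.span_singleton_le_iff_mem, Submodule.mem_comap, ha]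
      exact Submodule.mem_span_singleton_self a
    let ρB : Representation (ZMod p) Q (M ⧸ A) :=
      { toFun := fun g => A.mapQ A (ρ g) (hA g)
        map_one' := by ext x; simp
        map_mul' := fun g g' => by ext x; simp }
    have hρB : ∀ g x, ρB g (A.mkQ x) = A.mkQ (ρ g x) := fun g x => rfl
    have hfin : Module.finrank (ZMod p) (M ⧸ A) = k := by
      have h1 := Submodule.finrank_quotient_add_finrank A
      rw [finrank_span_singleton ha0, hM] at h1
      omega
    have : Finite (M ⧸ A) := Finite.of_surjective _ A.mkQ_surjective
    obtain ⟨b, hb, hbe, hbd⟩ := ih (M ⧸ A) hfin ρB (fun x => A.mkQ (f x)) (hf.comp _)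
      (fun g x => by rw [hfe, hρB])
      (fun x => by
        have := homD_map A.mkQ.toAddMonoidHom f x
        exact this.trans (by rw [hfd]; exact map_zero _))
    let s : M ⧸ A → M := Function.surjInv A.mkQ_surjective
    have hs : ∀ y, A.mkQ (s y) = y := Function.surjInv_eq A.mkQ_surjective
    -- The section `s` need not be equivariant; translating the first variable to 1 before applying
    -- it makes the lift equivariant.
    let b' : (Fin (m + 1) → G) → M := fun x => ρ (π (x 0)) (s (ρB (π (x 0))⁻¹ (b x)))
    have hπ0 : IsLocallyConstant fun x : Fin (m + 1) → G => π (x 0) :=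
      hπ.comp_continuous (continuous_apply 0)
    have hb' : IsLocallyConstant b' :=
      (hπ0.prodMk hb).comp fun z => ρ z.1 (s (ρB z.1⁻¹ z.2))
    have hb'e : ∀ (g : G) x, b' (fun i => g * x i) = ρ (π g) (b' x) := by
      intro g x
      simp only [b', hbe, map_mul, mul_inv_rev, Module.End.mul_apply]
      congr 3
      rw [← Module.End.mul_apply (ρB (π g)⁻¹), ← map_mul]
      simp
    have hb'b : ∀ x, A.mkQ (b' x) = b x := by
      intro x
      rw [← hρB, hs, ← Module.End.mul_apply, ← map_mul]
      simp
    obtain ⟨lam, hlam⟩ : ∃ lam : M →ₗ[ZMod p] ZMod p, lam a = 1 :=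
      Module.Projective.exists_dual_eq_one (ZMod p) ha0
    have hval : ∀ x, f x - homD b' x = lam (f x - homD b' x) • a := by
      intro x
      have h1 : f x - homD b' x ∈ A := by
        rw [← Submodule.ker_mkQ A, LinearMap.mem_ker, map_sub, sub_eq_zero]
        rw [← hbd x]
        have := homD_map A.mkQ.toAddMonoidHom b' x
        rw [← show (fun y => A.mkQ (b' y)) = b from funext hb'b]
        exact this
      obtain ⟨c, hc⟩ := Submodule.mem_span_singleton.1 h1
      rw [← hc, map_smul, hlam]
      simp
    have hDe : ∀ (g : G) x, homD b' (fun i => g * x i) = ρ (π g) (homD b' x) := by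
      intro g x
      rw [← homD_comp (fun y => g * y) b' x]
      have := homD_map (ρ (π g)).toAddMonoidHom b' x
      rw [show (fun y : Fin (m + 1) → G => b' fun i => g * y i) = fun y => ρ (π g) (b' y) from
        funext (hb'e g)]
      exact this
    obtain ⟨e, he, hee, hed⟩ := h (fun x => lam (f x - homD b' x))
      ((hf.sub (isLocallyConstant_homD hb')).comp lam)
      (by
        intro g x
        rw [hfe, hDe, ← map_sub, hval x, map_smul, ha])
      (by
        intro x
        have := homD_map lam.toAddMonoidHom (fun x => f x - homD b' x) x
        refine this.trans ?_
        rw [homD_sub, homD_homD, hfd]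
        simp)
    refine ⟨fun x => b' x + e x • a, hb'.add (he.comp fun c => c • a), ?_, ?_⟩
    · intro g x
      dsimp only
      rw [hb'e, hee, map_add, map_smul, ha]
    · intro x
      rw [homD_add]
      have := homD_map ((LinearMap.toSpanSingleton (ZMod p) M a).toAddMonoidHom) e x
      have h2 : homD (fun y => e y • a) x = homD e x • a := this
      rw [h2, hed, ← hval]
      abel

end Split

/-- Choosing a representative in each coset of `C` leaves a `C`-valued factor; dividing by its value
at 1 normalises it. -/
theorem exists_retraction {C Q : Type*} [CommGroup C] [Group Q] (j : C →* Q)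
    (hj : Function.Injective j) :
    ∃ R : Q → C, (∀ c q, R (j c * q) = c * R q) ∧ ∀ c, R (j c) = c := by
  have hex : ∀ q : Q, ∃ c : C, j c = q * (QuotientGroup.mk q⁻¹ : Q ⧸ j.range).out := by
    intro q
    have h : ((QuotientGroup.mk q⁻¹ : Q ⧸ j.range).out : Q ⧸ j.range) = QuotientGroup.mk q⁻¹ :=
      Quotient.out_eq _
    rw [eq_comm, QuotientGroup.eq, inv_inv] at h
    exact h
  choose R hR using hex
  have h1 : ∀ c q, R (j c * q) = c * R q := by
    intro c q
    apply hj
    have h2 : (QuotientGroup.mk (j c * q)⁻¹ : Q ⧸ j.range) = QuotientGroup.mk q⁻¹ := by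
      rw [QuotientGroup.eq, inv_inv, mul_inv_cancel_right]
      exact ⟨c, rfl⟩
    rw [hR, h2, map_mul, hR, mul_assoc]
  refine ⟨fun q => R q * (R 1)⁻¹, fun c q => by dsimp only; rw [h1, mul_assoc], fun c => ?_⟩
  have := h1 c 1
  rw [mul_one] at this
  dsimp only
  rw [this, mul_inv_cancel_right]

/-- Shapiro's argument at cochain level: a cocycle of `C` is coinduced to the finite module of
functions on Q/C, split over `G`, then restricted to `C` and evaluated at the trivial coset. -/
theorem TrivSplit.cocyclesSplit {p : ℕ} [Fact p.Prime] {G : Type u} [Group G] [TopologicalSpace G]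
    {Q : Type u} [Group Q] [Finite Q] (hQ : IsPGroup p Q) (π : G →* Q) (hπ : IsLocallyConstant π)
    {C : Type*} [CommGroup C] (i : C →* G) (hi : Function.Injective (π.comp i)) {m : ℕ}
    (h : TrivSplit p G m) : CocyclesSplit p C m := by
  intro Φ hΦ hΦd
  obtain ⟨R, hR, hR1⟩ := exists_retraction (π.comp i) hi
  let S := Q ⧸ (π.comp i).range
  let M := S → ZMod p
  let ρ : Representation (ZMod p) Q M :=
    { toFun := fun g => LinearMap.funLeft (ZMod p) (ZMod p) fun s => g⁻¹ • s
      map_one' := by ext φ s; simp [LinearMap.funLeft]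
      map_mul' := fun g g' => by
        ext φ s
        simp [LinearMap.funLeft, mul_smul] }
  have hρ : ∀ g (φ : M) s, ρ g φ s = φ (g⁻¹ • s) := fun _ _ _ => rfl
  have : Finite S := Quotient.finite _
  have hM : RepSplit π ρ m := h.repSplit hQ π hπ _ M rfl ρ
  -- By `hinv` below, invariance of `Φ` makes the value independent of the representative `s.out`;
  -- this gives equivariance.
  let f : (Fin (m + 2) → G) → M := fun x s => Φ fun k => R (s.out⁻¹ * π (x k))
  have hinv : ∀ (q q' : Q), (q : S) = q' → ∀ x : Fin (m + 2) → Q,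
      (Φ fun k => R (q⁻¹ * x k)) = Φ fun k => R (q'⁻¹ * x k) := by
    intro q q' hqq x
    obtain ⟨c, hc⟩ := QuotientGroup.eq.1 hqq
    have : ∀ k, q⁻¹ * x k = π.comp i c * (q'⁻¹ * x k) := fun k => by rw [hc]; group
    simp only [this, hR]
    exact hΦ c _
  have hS : ∀ (q : Q) (s : S), ((q * s.out : Q) : S) = q • s := fun q s =>
    congrArg (fun t : S => q • t) (Quotient.out_eq s : ((s.out : Q) : S) = s)
  have hfe : ∀ (g : G) x, f (fun k => g * x k) = ρ (π g) (f x) := by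
    intro g x
    funext s
    rw [hρ]
    have h1 := hinv ((π g)⁻¹ * s.out) ((π g)⁻¹ • s : S).out
      ((hS _ _).trans (Quotient.out_eq _).symm) fun k => π (x k)
    refine Eq.trans ?_ h1
    simp only [f, map_mul, mul_inv_rev, inv_inv, mul_assoc]
  have hfl : IsLocallyConstant f := by
    have h1 : IsLocallyConstant fun (x : Fin (m + 2) → G) (k : Fin (m + 2)) => π (x k) := by
      let _ : TopologicalSpace Q := ⊥
      have : DiscreteTopology Q := ⟨rfl⟩
      rw [IsLocallyConstant.iff_continuous]
      exact continuous_pi fun k => hπ.continuous.comp (continuous_apply k)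
    exact h1.comp fun (y : Fin (m + 2) → Q) (s : S) => Φ fun k => R (s.out⁻¹ * y k)
  have hev : ∀ (s : S) {n : ℕ} (F : (Fin n → G) → M) x,
      homD (fun y => F y s) x = homD F x s := fun s n F x =>
    homD_map (Pi.evalAddMonoidHom (fun _ : S => ZMod p) s) F x
  have hfd : ∀ x, homD f x = 0 := by
    intro x
    funext s
    rw [← hev]
    exact hΦd fun k => R (s.out⁻¹ * π (x k))
  obtain ⟨b, -, hbe, hbd⟩ := hM f hfl hfe hfd
  -- `C` fixes this coset, so evaluation there turns equivariance into invariance.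
  let s₀ : S := ((1 : Q) : S)
  refine ⟨fun y => b (fun k => i (y k)) s₀, ?_, ?_⟩
  · intro g y
    simp only [map_mul]
    rw [hbe, hρ]
    congr 1
    change (((π (i g))⁻¹ * 1 : Q) : S) = ((1 : Q) : S)
    rw [QuotientGroup.eq]
    exact ⟨g, by simp⟩
  · intro y
    have h1 : homD b (fun k => i (y k)) s₀ = Φ y := by
      rw [hbd]
      have h2 := hinv s₀.out 1 (Quotient.out_eq s₀) fun k => π (i (y k))
      refine h2.trans (congrArg Φ (funext fun k => ?_))
      rw [inv_one, one_mul]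
      exact hR1 (y k)
    rw [← h1, ← hev]
    rfl

/-- An element of order p survives in some finite p-quotient, so the group it generates embeds there
and would inherit vanishing in all high degrees. -/
theorem torsionFree_of_trivSplit {p : ℕ} [Fact p.Prime] {G : Type u} [Group G] [TopologicalSpace G]
    [IsTopologicalGroup G] [T2Space G] (hP : IsProP p G) {N : ℕ} (h : ∀ m, N ≤ m → TrivSplit p G m)
    (y : G) (hy : y ^ p = 1) : y = 1 := by
  by_contra hne
  obtain ⟨K, hK, hKo, ⟨k, hk⟩, hKy⟩ := hP {y}ᶜ (isOpen_compl_singleton.mem_nhds (Ne.symm hne))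
  have hyK : y ∉ K := fun h => hKy h rfl
  have hQ : IsPGroup p (G ⧸ K) := IsPGroup.of_card (n := k) hk
  have : Finite (G ⧸ K) := by
    refine Nat.finite_of_card_ne_zero ?_
    change K.index ≠ 0
    rw [hk]
    exact pow_ne_zero _ (Fact.out : p.Prime).ne_zero
  let π : G →* G ⧸ K := QuotientGroup.mk' K
  have hπ : IsLocallyConstant π := by
    have := QuotientGroup.discreteTopology hKo
    rw [IsLocallyConstant.iff_continuous]
    exact QuotientGroup.continuous_mk
  let i₀ : ZMod p →+ Additive G := ZMod.lift p ⟨zmultiplesHom (Additive G) (Additive.ofMul y), by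
    change ((p : ℤ) • Additive.ofMul y) = 0
    rw [natCast_zsmul]
    exact congrArg Additive.ofMul hy⟩
  let i : Cyc p →* G := AddMonoidHom.toMultiplicativeLeft i₀
  have hi : ∀ n : ℤ, i (Multiplicative.ofAdd (n : ZMod p)) = y ^ n := by
    intro n
    change (i₀ (n : ZMod p)).toMul = y ^ n
    rw [ZMod.lift_coe]
    rfl
  have hinj : Function.Injective (π.comp i) := by
    rw [injective_iff_map_eq_one]
    intro c hc
    by_contra hc1
    have hcard : Nat.card (Cyc p) = p :=
      (Nat.card_congr Multiplicative.toAdd).trans (Nat.card_zmod p)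
    have htop := zpowers_eq_top_of_prime_card hcard hc1
    have hmem : cycGen p ∈ Subgroup.zpowers c := by rw [htop]; trivial
    obtain ⟨n, hn⟩ := hmem
    have h1 : π.comp i (cycGen p) = 1 := by
      rw [← hn]
      simp only [map_zpow, hc, one_zpow]
    have h2 := hi 1
    rw [Int.cast_one, zpow_one] at h2
    have h3 : π y = 1 := by
      rw [← h2]
      exact h1
    exact hyK ((QuotientGroup.eq_one_iff y).1 h3)
  exact not_cocyclesSplit_odd N ((h (2 * N + 1) (by omega)).cocyclesSplit hQ π hπ i hinj)

/-! ### Quadratic algebras with square-zero generators -/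

theorem exteriorPower_eq_bot {k : Type*} {W : Type*} [Field k] [AddCommGroup W] [Module k W]
    [Module.Finite k W] {n : ℕ} (hn : Module.finrank k W < n) : ⋀[k]^n W = ⊥ := by
  have h1 : Module.finrank k (⋀[k]^n W) = 0 := by
    rw [exteriorPower.finrank_eq, Nat.choose_eq_zero_of_lt hn]
  exact Submodule.finrank_eq_zero.1 h1

/-- Only generation in degree one matters: A n is spanned by n-fold products from A 1, which factor
through the n-th exterior power. -/
theorem IsQuadraticAlgebra.subsingleton {k : Type} [Field k] {A : ℕ → Type u}
    [∀ n, AddCommGroup (A n)] [∀ n, Module k (A n)] [DirectSum.GSemiring A]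
    [DirectSum.GAlgebra k A] (h : IsQuadraticAlgebra k A) [Module.Finite k (A 1)]
    (hsq : ∀ a : A 1, DirectSum.lof k ℕ A 1 a * DirectSum.lof k ℕ A 1 a = 0) {n : ℕ}
    (hn : Module.finrank k (A 1) < n) : Subsingleton (A n) := by
  obtain ⟨Ω, e, he⟩ := h
  let ψ : TensorAlgebra k (A 1) →ₐ[k] ⨁ n, A n := e.toAlgHom.comp
    (RingQuot.mkAlgHom k fun a b : TensorAlgebra k (A 1) => b = 0 ∧ ∃ w ∈ Ω, a = tensorSquare w)
  have hψ : ∀ m, LinearMap.range (DirectSum.lof k ℕ A m) =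
      ((LinearMap.range (TensorAlgebra.ι k : A 1 →ₗ[k] TensorAlgebra k (A 1))).map
        ψ.toLinearMap) ^ m := by
    intro m
    rw [← he m, ← Submodule.map_pow, QuadAlg.component, ← Submodule.map_comp]
    rfl
  have h1 := hψ 1
  rw [pow_one] at h1
  have hpow : LinearMap.range (DirectSum.lof k ℕ A n) =
      LinearMap.range (DirectSum.lof k ℕ A 1) ^ n := by rw [hψ n, h1]
  let Λ : ExteriorAlgebra k (A 1) →ₐ[k] ⨁ n, A n :=
    ExteriorAlgebra.lift k ⟨DirectSum.lof k ℕ A 1, hsq⟩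
  have hΛ : (LinearMap.range (ExteriorAlgebra.ι k : A 1 →ₗ[k] _)).map Λ.toLinearMap =
      LinearMap.range (DirectSum.lof k ℕ A 1) := by
    rw [← LinearMap.range_comp]
    congr 1
    exact ExteriorAlgebra.ι_comp_lift k _ hsq
  have hbot : LinearMap.range (DirectSum.lof k ℕ A n) = ⊥ := by
    have h2 : (LinearMap.range (ExteriorAlgebra.ι k : A 1 →ₗ[k] _)) ^ n = ⊥ :=
      exteriorPower_eq_bot hn
    rw [hpow, ← hΛ, ← Submodule.map_pow, h2, Submodule.map_bot]
  refine ⟨fun a b => ?_⟩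
  have hz : ∀ a : A n, a = 0 := by
    intro a
    have h3 : DirectSum.lof k ℕ A n a ∈ LinearMap.range (DirectSum.lof k ℕ A n) := ⟨a, rfl⟩
    rw [hbot, Submodule.mem_bot] at h3
    exact DirectSum.of_injective n (h3.trans (map_zero (DirectSum.of A n)).symm)
  rw [hz a, hz b]

/-! ### One-cocycles and their cup squares -/

section Cohom

variable {p : ℕ} {G : Type u} [Group G] [TopologicalSpace G] [IsTopologicalGroup G]

theorem IsHQuadratic.cocycles_le [Fact p.Prime] (h : IsHQuadratic p G)
    [Module.Finite (ZMod p) (Cohomology p G 1)]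
    (hsq : ∀ χ ∈ cocycles p G 1, cup χ χ ∈ coboundaries p G (1 + 1)) {n : ℕ}
    (hn : Module.finrank (ZMod p) (Cohomology p G 1) < n) :
    cocycles p G n ≤ coboundaries p G n := by
  have hs : Subsingleton (Cohomology p G n) := by
    refine IsQuadraticAlgebra.subsingleton h ?_ hn
    intro a
    obtain ⟨⟨χ, hχ⟩, rfl⟩ := Submodule.Quotient.mk_surjective _ a
    change DirectSum.of _ 1 _ * DirectSum.of _ 1 _ = 0
    rw [DirectSum.of_mul_of]
    have : (GradedMonoid.GMul.mul (cls χ hχ) (cls χ hχ) : Cohomology p G (1 + 1)) = 0 := by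
      change cupH (cls χ hχ) (cls χ hχ) = 0
      rw [cupH_cls]
      exact (Submodule.Quotient.mk_eq_zero _).2 (hsq χ hχ)
    refine Eq.trans (congrArg _ this) (map_zero _)
  intro f hf
  have h0 : cls f hf = 0 := Subsingleton.elim _ _
  exact (Submodule.Quotient.mk_eq_zero ((coboundaries p G n).submoduleOf (cocycles p G n))).1 h0

theorem mem_cocycles_one {χ : Cochain p G 1} :
    χ ∈ cocycles p G 1 ↔ ∀ g h : G, χ (fun _ => g * h) = χ (fun _ => g) + χ fun _ => h := by
  have key : ∀ v : Fin 2 → G, d p G 1 χ v =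
      χ (fun _ => v 1) - χ (fun _ => v 0 * v 1) + χ fun _ => v 0 := by
    intro v
    rw [d_apply, Fin.sum_univ_two]
    have e1 : (fun i : Fin 1 => v i.succ) = fun _ => v 1 := by
      funext i; rw [Subsingleton.elim i 0]; rfl
    have e2 : Fin.contractNth 0 (· * ·) v = fun _ : Fin 1 => v 0 * v 1 := by
      funext i; rw [Subsingleton.elim i 0]; rfl
    have e3 : Fin.contractNth 1 (· * ·) v = fun _ : Fin 1 => v 0 := by
      funext i; rw [Subsingleton.elim i 0]; rfl
    rw [e1, e2, e3]
    simp
    ring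
  constructor
  · intro h a b
    have h1 : d p G 1 χ = 0 := h
    have h2 := key ![a, b]
    rw [h1] at h2
    have h3 : (0 : ZMod p) = χ (fun _ => b) - χ (fun _ => a * b) + χ fun _ => a := h2
    linear_combination h3
  · intro h
    change d p G 1 χ = 0
    ext v
    rw [key, h]
    simp

theorem cup_self_mem_coboundaries {χ : Cochain p G 1} {c : G → ZMod p} (hc : IsLocallyConstant c)
    (h : ∀ a b, c (a * b) = c a + c b + χ (fun _ => a) * χ fun _ => b) :
    cup χ χ ∈ coboundaries p G (1 + 1) := by
  let b : Cochain p G 1 := ⟨fun v => - c (v 0), (hc.comp_continuous (continuous_apply 0)).neg⟩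
  refine ⟨b, ?_⟩
  ext v
  rw [d_apply, Fin.sum_univ_two, cup_apply]
  change - c (v 1) + ((-1) ^ (0 + 1) * (- c (v 0 * v 1)) + (-1) ^ (1 + 1) * (- c (v 0))) = _
  rw [h]
  have e1 : (fun i : Fin 1 => v (Fin.castAdd 1 i)) = fun _ => v 0 := by
    funext i; rw [Subsingleton.elim i 0]; rfl
  have e2 : (fun i : Fin 1 => v (Fin.natAdd 1 i)) = fun _ => v 1 := by
    funext i; rw [Subsingleton.elim i 0]; rfl
  rw [e1, e2]
  ring

theorem isLocallyConstant_cochain_one {p : ℕ} {G : Type u} [TopologicalSpace G]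
    (χ : Cochain p G 1) : IsLocallyConstant fun g : G => χ fun _ => g :=
  χ.isLocallyConstant.comp_continuous (by fun_prop : Continuous fun (g : G) (_ : Fin 1) => g)

theorem cup_self_mem_coboundaries_of_odd [Fact p.Prime] (hp : p ≠ 2) {χ : Cochain p G 1}
    (hχ : χ ∈ cocycles p G 1) : cup χ χ ∈ coboundaries p G (1 + 1) := by
  have h2 : (2 : ZMod p) ≠ 0 := by
    intro h
    have h1 : ((2 : ℕ) : ZMod p) = 0 := by exact_mod_cast h
    rw [ZMod.natCast_eq_zero_iff] at h1
    exact hp ((Nat.prime_dvd_prime_iff_eq Fact.out Nat.prime_two).1 h1)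
  -- Half the square has the product χ(a)χ(b) as its defect from additivity.
  refine cup_self_mem_coboundaries (c := fun g => (χ fun _ => g) ^ 2 / 2)
    ((isLocallyConstant_cochain_one χ).comp fun t => t ^ 2 / 2) fun a b => ?_
  rw [mem_cocycles_one.1 hχ]
  field_simp
  ring

/-- The parity of n choose 2 depends only on n modulo 4, and its defect from additivity is the
product; so a lift to ℤ/4 supplies the function that half the square supplies for odd p. -/
theorem cup_self_mem_coboundaries_of_lift {χ : Cochain 2 G 1}
    (F : G →* Multiplicative (ZMod 4)) (hF : IsLocallyConstant F)
    (h : ∀ g, (χ fun _ => g) = ZMod.castHom (by norm_num : 2 ∣ 4) (ZMod 2) (F g).toAdd) :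
    cup χ χ ∈ coboundaries 2 G (1 + 1) := by
  have key : ∀ s t : ZMod 4, ((((s + t).val).choose 2 : ℕ) : ZMod 2) =
      ((s.val.choose 2 : ℕ) : ZMod 2) + ((t.val.choose 2 : ℕ) : ZMod 2) +
      ZMod.castHom (by norm_num : 2 ∣ 4) (ZMod 2) s *
        ZMod.castHom (by norm_num : 2 ∣ 4) (ZMod 2) t := by
    decide
  refine cup_self_mem_coboundaries
    (c := fun g => (((F g).toAdd.val.choose 2 : ℕ) : ZMod 2))
    (hF.comp fun t => ((t.toAdd.val.choose 2 : ℕ) : ZMod 2)) fun a b => ?_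
  rw [h, h, map_mul, toAdd_mul, key]

end Cohom

/-! ### Cohomology of a `p`-RAAG and uniformity -/

namespace PGraph

variable {p : ℕ} [Fact p.Prime] {V : Type u} (Γ : PGraph p V)

/-- A one-cocycle as a homomorphism. -/
def cocycleHom {G : Type u} [Group G] [TopologicalSpace G] [IsTopologicalGroup G]
    (χ : cocycles p G 1) : G →* Multiplicative (ZMod p) :=
  MonoidHom.mk' (fun g => Multiplicative.ofAdd (χ.1 fun _ => g)) fun a b =>
    congrArg Multiplicative.ofAdd (mem_cocycles_one.1 χ.2 a b)

theorem hom_ext {H : Type*} [Group H] {F₁ F₂ : Γ.raag →* H} (h₁ : IsLocallyConstant F₁)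
    (h₂ : IsLocallyConstant F₂) (h : ∀ v, F₁ (Γ.gen v) = F₂ (Γ.gen v)) : F₁ = F₂ := by
  let _ : TopologicalSpace H := ⊥
  have : DiscreteTopology H := ⟨rfl⟩
  have h3 : F₁.eqLocus F₂ = ⊤ := by
    refine eqOn_of_dense Γ.dense_closure_range_gen _ ?_ ?_
    · exact isClosed_eq h₁.continuous h₂.continuous
    · rintro _ ⟨v, rfl⟩
      exact h v
  refine MonoidHom.ext fun x => ?_
  have : x ∈ F₁.eqLocus F₂ := by rw [h3]; trivial
  exact this

theorem cocycle_ext {χ₁ χ₂ : cocycles p Γ.raag 1}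
    (h : ∀ v, (χ₁.1 fun _ => Γ.gen v) = χ₂.1 fun _ => Γ.gen v) : χ₁ = χ₂ := by
  have h1 : cocycleHom χ₁ = cocycleHom χ₂ := by
    refine Γ.hom_ext ((isLocallyConstant_cochain_one χ₁.1).comp Multiplicative.ofAdd)
      ((isLocallyConstant_cochain_one χ₂.1).comp Multiplicative.ofAdd) fun v => ?_
    exact congrArg Multiplicative.ofAdd (h v)
  apply Subtype.ext
  ext x
  have h2 := congrArg Multiplicative.toAdd (DFunLike.congr_fun h1 (x 0))
  have h3 : x = fun _ => x 0 := by funext i; rw [Subsingleton.elim i 0]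
  rw [h3]
  exact h2

instance [Finite V] : Module.Finite (ZMod p) (Cohomology p Γ.raag 1) := by
  let E : cocycles p Γ.raag 1 →ₗ[ZMod p] (V → ZMod p) :=
    { toFun := fun χ v => χ.1 fun _ => Γ.gen v
      map_add' := fun _ _ => rfl
      map_smul' := fun _ _ => rfl }
  have hE : Function.Injective E := fun χ₁ χ₂ h => Γ.cocycle_ext (congrFun h)
  have : Module.Finite (ZMod p) (cocycles p Γ.raag 1) := Module.Finite.of_injective E hE
  infer_instance

/-- For p = 2 the values of χ on generators are lifted to ℤ/4; the lift extends to the group because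
this target has exponent 4, the power dividing all labels. -/
theorem cup_self_mem {χ : Cochain p Γ.raag 1} (hχ : χ ∈ cocycles p Γ.raag 1) :
    cup χ χ ∈ coboundaries p Γ.raag (1 + 1) := by
  by_cases hp : p = 2
  · subst hp
    let _ : TopologicalSpace (Multiplicative (ZMod 4)) := ⊥
    have : DiscreteTopology (Multiplicative (ZMod 4)) := ⟨rfl⟩
    have hcard : Nat.card (Multiplicative (ZMod 4)) = 2 ^ 2 :=
      (Nat.card_congr Multiplicative.toAdd).trans (Nat.card_zmod 4)
    obtain ⟨F, hF, hFv⟩ := Γ.exists_hom (Q := Multiplicative (ZMod 4)) (IsPGroup.of_card hcard)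
      (fun v => Multiplicative.ofAdd ((χ fun _ => Γ.gen v).val : ZMod 4))
      (fun v => by
        have h : labelPow 2 = Nat.card (Multiplicative (ZMod 4)) := by rw [hcard]; rfl
        rw [h]
        exact pow_card_eq_one')
      (fun e _ => Commute.all _ _)
    have hFl : IsLocallyConstant F := (IsLocallyConstant.iff_continuous F).2 hF
    refine cup_self_mem_coboundaries_of_lift F hFl fun g => ?_
    let red : Multiplicative (ZMod 4) →* Multiplicative (ZMod 2) := AddMonoidHom.toMultiplicative
      (ZMod.castHom (by norm_num : 2 ∣ 4) (ZMod 2)).toAddMonoidHom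
    have h1 : cocycleHom ⟨χ, hχ⟩ = red.comp F := by
      refine Γ.hom_ext ((isLocallyConstant_cochain_one χ).comp Multiplicative.ofAdd)
        (hFl.comp red) fun v => ?_
      rw [MonoidHom.comp_apply, hFv]
      have h2 : ZMod.castHom (by norm_num : 2 ∣ 4) (ZMod 2)
          ((χ fun _ => Γ.gen v).val : ZMod 4) = χ fun _ => Γ.gen v := by
        rw [map_natCast, ZMod.natCast_zmod_val]
      exact congrArg Multiplicative.ofAdd h2.symm
    exact congrArg Multiplicative.toAdd (DFunLike.congr_fun h1 g)
  · exact cup_self_mem_coboundaries_of_odd hp hχ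

theorem isUniform [Finite V] (hq : IsHQuadratic p Γ.raag) (hG : IsPowerful p Γ.raag) :
    IsUniform p Γ.raag := by
  classical
  have := Fintype.ofFinite V
  refine isUniform_of_torsionFree Γ.isProP_raag ⟨Finset.univ.image Γ.gen, ?_⟩ hG ?_
  · have h := Γ.dense_closure_range_gen
    rw [Finset.coe_image, Finset.coe_univ, Set.image_univ]
    apply SetLike.coe_injective
    rw [Subgroup.topologicalClosure_coe, h.closure_eq]
    rfl
  · refine torsionFree_of_trivSplit Γ.isProP_raag
      (N := Module.finrank (ZMod p) (Cohomology p Γ.raag 1)) fun m hm => ?_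
    exact trivSplit_of_le_coboundaries
      (hq.cocycles_le (fun χ hχ => Γ.cup_self_mem hχ) (by omega))

end PGraph

end PRAAG

end

theorem theoremI (p : ℕ) [Fact p.Prime] (V : Type*) [Finite V] (Γ : PRAAG.PGraph p V) :
    (PRAAG.IsPowerful p Γ.raag ∨ PRAAG.ContainsFreeNonabelianProP p Γ.raag) ∧
    (PRAAG.IsHQuadratic p Γ.raag →
      PRAAG.IsUniform p Γ.raag ∨ PRAAG.ContainsFreeNonabelianProP p Γ.raag) := by
  by_cases h : ∀ v w, v ≠ w → (v, w) ∈ Γ.edges ∨ (w, v) ∈ Γ.edges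
  · exact ⟨Or.inl (Γ.isPowerful h), fun hq => Or.inl (Γ.isUniform hq (Γ.isPowerful h))⟩
  · push Not at h
    obtain ⟨v, w, hvw, h1, h2⟩ := h
    have hfree := Γ.containsFree v w hvw h1 h2
    exact ⟨Or.inr hfree, fun _ => Or.inr hfree⟩
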